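/- **Setting.** Let $k$ be an integer. A $4k$-dimensional symmetric complex $(C,\phi)$ over $\mathbb Z$ is a finite chain complex $C$ of finitely generated free abelian groups together with elements $\phi_s\in (C\otimes_{\mathbb Z} C)_{4k+s}$, $s\ge 0$, such that, with $\phi_{-1}=0$, $$d\phi_s+(-1)^{4k+s-1}\bigl(\phi_{s-1}+(-1)^sT\phi_{s-1}\bigr)=0\qquad(s\ge 0),$$ where $T(x\otimes y)=(-1)^{pq}\,y\otimes x$ and $d(x\otimes y)=x\otimes dy+(-1)^q dx\otimes y$ for $x\in C_p$, $y\in C_q$. It is a symmetric Poincaré complex if the chain map $\phi_0\colon C^{4k-*}\to C$ is a chain equivalence. For cochains $u,v$ of $C$ write $\phi_s(u,v)$ for the evaluation of $u\otimes v$ on $\phi_s$. The signature $\sigma(C,\phi)\in\mathbb Z$ is the signature of the symmetric form induced by $\phi_0$ on $H^{2k}(C;\mathbb R)$; $\lambda$ is the symmetric form induced by $\phi_0$ on $H^{2k}(C;\mathbb Z_2)$. A class in $H^{2k}(C;\mathbb Z_2)$ is represented by a pair of homomorphisms $u\colon C_{2k}\to\mathbb Z$, $v\colon C_{2k+1}\to\mathbb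 Z$ with $u\circ d=2v$ (the class is that of $u$ mod $2$), and the Pontryagin square is the well-defined function $$\mathcal P_2\colon H^{2k}(C;\mathbb Z_2)\to\mathbb Z_4,\qquad (u,v)\mapsto \phi_0(u,u)+2\phi_1(v,u).$$ A subspace $L\subseteq H^{2k}(C;\mathbb Z_2)$ is a sublagrangian of $(H^{2k}(C;\mathbb Z_2),\lambda,\mathcal P_2)$ if $\lambda$ vanishes on $L\times L$ and $\mathcal P_2$ vanishes on $L$; and $L^\perp=\{x\mid \lambda(y,x)=0 \text{ for all } y\in L\}$. The Arf invariant $\mathrm{Arf}(W,\mu,h)\in\mathbb Z_2$ of a nonsingular quadratic form over $\mathbb Z_2$ on a finite vector space is the value that $h$ takes most often. **Theorem.** Let $(C,\phi)$ be a $4k$-dimensional symmetric Poincaré complex over $\mathbb Z$. There is a unique class $v_{2k}\in H^{2k}(C;\mathbb Z_2)$ (the Wu class) such that $\lambda(x,x)=\lambda(x,v_{2k})$ for all $x\in H^{2k}(C;\mathbb Z_2)$. Let $L=\langle v_{2k}\rangle$ be its span. Then $$\sigma(C,\phi)\equiv 0 \pmod 4\iff L\text{ is a sublagrangian of }(H^{2k}(C;\mathbb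 Z_2),\lambda,\mathcal P_2).$$ If this is the case, then $L\subseteq L^\perp$, the form $\lambda$ induces a nonsingular symmetric form $\mu=[\lambda]$ on $W=L^\perp/L$, there is a $\mathbb Z_2$-valued quadratic enhancement $h=[\mathcal P_2]/2$ of $\mu$, that is, a function $h\colon W\to\mathbb Z_2$ with $h(x+y)=h(x)+h(y)+\mu(x,y)$ for $x,y\in W$ and $\mathcal P_2(x)=2\,h([x])\in\mathbb Z_4$ for $x\in L^\perp$ (where $2\colon\mathbb Z_2\to\mathbb Z_4$ is the injection), and $$\sigma(C,\phi)=4\,\mathrm{Arf}(W,\mu,h)\in 4\mathbb Z_2\subset\mathbb Z_8.$$ -/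

import Mathlib

open CategoryTheory TensorProduct

universe u

noncomputable section

/-! ### Evaluation of tensors on cochains -/

/-- `(u ⊗ v)(x) ∈ R` for `x ∈ M ⊗ N` and homomorphisms `u : M → R`, `v : N → R`. -/
def tensorEval {M N R : Type*} [AddCommGroup M] [AddCommGroup N] [CommRing R]
    (u : M →ₗ[ℤ] R) (v : N →ₗ[ℤ] R) : M ⊗[ℤ] N →ₗ[ℤ] R :=
  LinearMap.mul' ℤ R ∘ₗ TensorProduct.map u v

@[simp] theorem tensorEval_tmul {M N R : Type*} [AddCommGroup M] [AddCommGroup N] [CommRing R]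
    (u : M →ₗ[ℤ] R) (v : N →ₗ[ℤ] R) (x : M) (y : N) :
    tensorEval u v (x ⊗ₜ[ℤ] y) = u x * v y := by
  change LinearMap.mul' ℤ R (TensorProduct.map u v (x ⊗ₜ[ℤ] y)) = u x * v y
  rw [TensorProduct.map_tmul]
  exact LinearMap.mul'_apply

/-- The homomorphism `Hom(M, ℤ) → N`, `f ↦ (f ⊗ 1)(x)`, adjoint to `x ∈ M ⊗ N`. -/
def tensorSlant {M N : Type*} [AddCommGroup M] [AddCommGroup N] (x : M ⊗[ℤ] N) :
    (M →ₗ[ℤ] ℤ) →+ N where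
  toFun f := TensorProduct.lid ℤ N (f.rTensor N x)
  map_zero' := by simp
  map_add' f g := by simp [LinearMap.rTensor_add]

theorem tensorSlant_lTensor {M N P : Type*} [AddCommGroup M] [AddCommGroup N] [AddCommGroup P]
    (D : N →ₗ[ℤ] P) (x : M ⊗[ℤ] N) (f : M →ₗ[ℤ] ℤ) :
    tensorSlant (D.lTensor M x) f = D (tensorSlant x f) := by
  induction x using TensorProduct.induction_on with
  | zero => simp [tensorSlant]
  | tmul a b => simp [tensorSlant]
  | add a b ha hb => simp_all [tensorSlant]

theorem tensorSlant_rTensor {M N P : Type*} [AddCommGroup M] [AddCommGroup N] [AddCommGroup P]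
    (D : M →ₗ[ℤ] P) (x : M ⊗[ℤ] N) (f : P →ₗ[ℤ] ℤ) :
    tensorSlant (D.rTensor N x) f = tensorSlant x (f ∘ₗ D) := by
  induction x using TensorProduct.induction_on with
  | zero => simp [tensorSlant]
  | tmul a b => simp [tensorSlant]
  | add a b ha hb => simp_all [tensorSlant]

section tensorEval

variable {M N P R : Type*} [AddCommGroup M] [AddCommGroup N] [AddCommGroup P] [CommRing R]

theorem tensorEval_lTensor (D : N →ₗ[ℤ] P) (u : M →ₗ[ℤ] R) (v : P →ₗ[ℤ] R) (x : M ⊗[ℤ] N) :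
    tensorEval u v (D.lTensor M x) = tensorEval u (v ∘ₗ D) x := by
  induction x using TensorProduct.induction_on with
  | zero => simp
  | tmul a b => simp
  | add a b ha hb => simp only [map_add, ha, hb]

theorem tensorEval_rTensor (D : M →ₗ[ℤ] P) (u : P →ₗ[ℤ] R) (v : N →ₗ[ℤ] R) (x : M ⊗[ℤ] N) :
    tensorEval u v (D.rTensor N x) = tensorEval (u ∘ₗ D) v x := by
  induction x using TensorProduct.induction_on with
  | zero => simp
  | tmul a b => simp
  | add a b ha hb => simp only [map_add, ha, hb]

theorem tensorEval_comm (u : M →ₗ[ℤ] R) (v : N →ₗ[ℤ] R) (x : N ⊗[ℤ] M) :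
    tensorEval u v (TensorProduct.comm ℤ N M x) = tensorEval v u x := by
  induction x using TensorProduct.induction_on with
  | zero => simp
  | tmul a b => simp [mul_comm]
  | add a b ha hb => simp only [map_add, ha, hb]

theorem tensorEval_add_left (u u' : M →ₗ[ℤ] R) (v : N →ₗ[ℤ] R) (x : M ⊗[ℤ] N) :
    tensorEval (u + u') v x = tensorEval u v x + tensorEval u' v x := by
  induction x using TensorProduct.induction_on with
  | zero => simp
  | tmul a b => simp [add_mul]
  | add a b ha hb => simp only [map_add, ha, hb]; ring

theorem tensorEval_add_right (u : M →ₗ[ℤ] R) (v v' : N →ₗ[ℤ] R) (x : M ⊗[ℤ] N) :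
    tensorEval u (v + v') x = tensorEval u v x + tensorEval u v' x := by
  induction x using TensorProduct.induction_on with
  | zero => simp
  | tmul a b => simp [mul_add]
  | add a b ha hb => simp only [map_add, ha, hb]; ring

theorem tensorEval_smul_left (c : R) (u : M →ₗ[ℤ] R) (v : N →ₗ[ℤ] R) (x : M ⊗[ℤ] N) :
    tensorEval (c • u) v x = c • tensorEval u v x := by
  induction x using TensorProduct.induction_on with
  | zero => simp
  | tmul a b => simp [mul_assoc]
  | add a b ha hb => simp only [map_add, ha, hb, smul_add]

theorem tensorEval_smul_right (c : R) (u : M →ₗ[ℤ] R) (v : N →ₗ[ℤ] R) (x : M ⊗[ℤ] N) :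
    tensorEval u (c • v) x = c • tensorEval u v x := by
  induction x using TensorProduct.induction_on with
  | zero => simp
  | tmul a b => simp [mul_left_comm]
  | add a b ha hb => simp only [map_add, ha, hb, smul_add]

end tensorEval

/-! ### Symmetric complexes over `ℤ` -/

/-- The differential `C_p → C_q` of a complex of abelian groups, as a `ℤ`-linear map
(it is zero unless `p = q + 1`). -/
abbrev chainD (C : ChainComplex AddCommGrpCat.{u} ℤ) (p q : ℤ) : C.X p →ₗ[ℤ] C.X q :=
  (C.d p q).hom.toIntLinearMap

/-- An `n`-dimensional symmetric complex `(C, φ)` over `ℤ`: a finite chain complex `C` of finitely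
generated free abelian groups together with an `n`-dimensional cycle
`φ ∈ Hom_{ℤ[ℤ/2]}(W, C ⊗ C)_n`, where `W` is the standard free `ℤ[ℤ/2]`-resolution of `ℤ`.
Explicitly `φ` is a sequence `φ_s ∈ (C ⊗ C)_{n+s}`, `s ≥ 0`, with components
`φ s p q ∈ C_p ⊗ C_q`, such that (with `φ_{-1} = 0`)
`d φ_s + (-1)^(n+s-1) (φ_{s-1} + (-1)^s T φ_{s-1}) = 0`.
Here `T (x ⊗ y) = (-1)^(pq) y ⊗ x` and `d (x ⊗ y) = x ⊗ d y + (-1)^q d x ⊗ y`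
for `x ∈ C_p`, `y ∈ C_q`. -/
structure SymmetricComplex (n : ℤ) where
  C : ChainComplex AddCommGrpCat.{u} ℤ
  free : ∀ p, Module.Free ℤ (C.X p)
  finite : ∀ p, Module.Finite ℤ (C.X p)
  bounded : ∃ N : ℤ, ∀ p, N < |p| → Subsingleton (C.X p)
  φ : ℕ → ∀ p q : ℤ, (C.X p) ⊗[ℤ] (C.X q)
  degree : ∀ (s : ℕ) (p q : ℤ), p + q ≠ n + s → φ s p q = 0
  cycle_zero : ∀ p q : ℤ,
    (chainD C (q + 1) q).lTensor (C.X p) (φ 0 p (q + 1))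
      + (q.negOnePow : ℤ) • (chainD C (p + 1) p).rTensor (C.X q) (φ 0 (p + 1) q) = 0
  cycle_succ : ∀ (s : ℕ) (p q : ℤ),
    (chainD C (q + 1) q).lTensor (C.X p) (φ (s + 1) p (q + 1))
      + (q.negOnePow : ℤ) • (chainD C (p + 1) p).rTensor (C.X q) (φ (s + 1) (p + 1) q)
      + ((n + s).negOnePow : ℤ) • (φ s p q + (((s : ℤ) + 1).negOnePow : ℤ) •
          ((p * q).negOnePow : ℤ) • TensorProduct.comm ℤ (C.X q) (C.X p) (φ s q p)) = 0

/-- The dual complex `C^{n-*}`: in degree `r` it is `C^{n-r} = Hom(C_{n-r}, ℤ)`, with differential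
`(-1)^r d^* : C^{n-r} → C^{n-r+1}`. -/
def dualComplex (C : ChainComplex AddCommGrpCat.{u} ℤ) (n : ℤ) :
    ChainComplex AddCommGrpCat.{u} ℤ where
  X r := AddCommGrpCat.of (C.X (n - r) →ₗ[ℤ] ℤ)
  d r s := AddCommGrpCat.ofHom
    { toFun := fun f => (r.negOnePow : ℤ) • (f ∘ₗ chainD C (n - s) (n - r))
      map_zero' := by simp
      map_add' := fun f g => by simp [LinearMap.add_comp] }
  shape r s h := by
    have h0 : C.d (n - s) (n - r) = 0 := C.shape _ _ (by
      simp only [ComplexShape.down_Rel] at h ⊢; omega)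
    ext f x
    simp [chainD, h0]
  d_comp_d' i j k _ _ := by
    have h0 : ∀ x, (C.d (n - j) (n - i)) ((C.d (n - k) (n - j)) x) = 0 := fun x => by
      rw [← ConcreteCategory.comp_apply, C.d_comp_d]; rfl
    ext f x
    simp [chainD, h0]

namespace SymmetricComplex

variable {n : ℤ} (X : SymmetricComplex.{u} n)

theorem cycle_zero' {p p' q q' : ℤ} (hp : p' = p + 1) (hq : q' = q + 1) :
    (chainD X.C q' q).lTensor (X.C.X p) (X.φ 0 p q')
      + (q.negOnePow : ℤ) • (chainD X.C p' p).rTensor (X.C.X q) (X.φ 0 p' q) = 0 := by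
  subst hp hq
  exact X.cycle_zero p q

/-- The chain map `φ_0 : C^{n-*} → C`. -/
def dualityMap : dualComplex X.C n ⟶ X.C where
  f r := AddCommGrpCat.ofHom (tensorSlant (X.φ 0 (n - r) r))
  comm' i j hij := by
    have hi : i = j + 1 := by simpa using hij.symm
    have h := X.cycle_zero' (p := n - i) (p' := n - j) (q := j) (q' := i) (by omega) hi
    have key : ∀ f : X.C.X (n - i) →ₗ[ℤ] ℤ, chainD X.C i j (tensorSlant (X.φ 0 (n - i) i) f) =
        tensorSlant (X.φ 0 (n - j) j)
          ((i.negOnePow : ℤ) • (f ∘ₗ chainD X.C (n - j) (n - i))) := fun f => by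
      have h' := congrArg (fun t => tensorSlant t f) h
      have hadd : ∀ (a b : X.C.X (n - i) ⊗[ℤ] X.C.X j),
          tensorSlant (a + b) f = tensorSlant a f + tensorSlant b f := fun a b => by
        simp [tensorSlant]
      have hsmul : ∀ (c : ℤ) (a : X.C.X (n - i) ⊗[ℤ] X.C.X j),
          tensorSlant (c • a) f = c • tensorSlant a f := fun c a => by
        simp [tensorSlant]
      have hzero : tensorSlant (0 : X.C.X (n - i) ⊗[ℤ] X.C.X j) f = 0 := by simp [tensorSlant]
      simp only [hadd, hsmul, hzero, tensorSlant_lTensor, tensorSlant_rTensor] at h'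
      have hs : (i.negOnePow : ℤ) = -(j.negOnePow : ℤ) := by simp [hi, Int.negOnePow_succ]
      rw [map_zsmul, eq_neg_of_add_eq_zero_left h', hs, neg_smul]
    ext f
    exact key f

/-- `(C, φ)` is a symmetric Poincaré complex if `φ_0 : C^{n-*} → C` is a chain equivalence. -/
def IsPoincare : Prop :=
  HomologicalComplex.homotopyEquivalences AddCommGrpCat.{u} (ComplexShape.down ℤ) X.dualityMap

/-! ### Cohomology with coefficients and the cup form -/

variable (R : Type) [CommRing R]

/-- The coboundary `Hom(C_p, R) → Hom(C_q, R)`, `u ↦ u ∘ d` (zero unless `q = p + 1`). -/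
def coboundary (p q : ℤ) : (X.C.X p →ₗ[ℤ] R) →ₗ[R] (X.C.X q →ₗ[ℤ] R) where
  toFun u := u ∘ₗ chainD X.C q p
  map_add' _ _ := LinearMap.add_comp _ _ _
  map_smul' _ _ := LinearMap.smul_comp _ _ _

/-- The cocycles in `Hom(C_p, R)`. -/
def cocycles (p : ℤ) : Submodule R (X.C.X p →ₗ[ℤ] R) :=
  LinearMap.ker (X.coboundary R p (p + 1))

/-- The coboundaries in `Hom(C_p, R)`. -/
def coboundaries (p : ℤ) : Submodule R (X.C.X p →ₗ[ℤ] R) :=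
  LinearMap.range (X.coboundary R (p - 1) p)

/-- The cohomology `H^p(C; R)`. -/
abbrev Cohomology (p : ℤ) : Type u :=
  X.cocycles R p ⧸ (X.coboundaries R p).submoduleOf (X.cocycles R p)

variable {R}

/-- The `R`-bilinear pairing `(u, v) ↦ φ_s(u, v)` of cochains with values in `R`. -/
def cochainPairing (s : ℕ) (p q : ℤ) :
    (X.C.X p →ₗ[ℤ] R) →ₗ[R] (X.C.X q →ₗ[ℤ] R) →ₗ[R] R :=
  LinearMap.mk₂ R (fun u v => tensorEval u v (X.φ s p q))
    (fun u u' v => tensorEval_add_left u u' v _) (fun a u v => tensorEval_smul_left a u v _)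
    (fun u v v' => tensorEval_add_right u v v' _) (fun a u v => tensorEval_smul_right a u v _)

theorem pairing_zero_relation {p p' q q' : ℤ} (hp : p' = p + 1) (hq : q' = q + 1)
    (u : X.C.X p →ₗ[ℤ] R) (v : X.C.X q →ₗ[ℤ] R) :
    X.cochainPairing 0 p q' u (X.coboundary R q q' v)
      + (q.negOnePow : ℤ) • X.cochainPairing 0 p' q (X.coboundary R p p' u) v = 0 := by
  have h := congrArg (tensorEval u v) (X.cycle_zero' hp hq)
  simp only [map_add, map_zsmul, map_zero, tensorEval_lTensor, tensorEval_rTensor] at h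
  exact h

theorem pairing_succ_relation (s : ℕ) {p p' q q' : ℤ} (hp : p' = p + 1) (hq : q' = q + 1)
    (u : X.C.X p →ₗ[ℤ] R) (v : X.C.X q →ₗ[ℤ] R) :
    X.cochainPairing (s + 1) p q' u (X.coboundary R q q' v)
      + (q.negOnePow : ℤ) • X.cochainPairing (s + 1) p' q (X.coboundary R p p' u) v
      + ((n + s).negOnePow : ℤ) • (X.cochainPairing s p q u v
        + (((s : ℤ) + 1).negOnePow : ℤ) • ((p * q).negOnePow : ℤ) •
          X.cochainPairing s q p v u) = 0 := by
  subst hp hq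
  have h := congrArg (tensorEval u v) (X.cycle_succ s p q)
  simp only [map_add, map_zsmul, map_zero, tensorEval_lTensor, tensorEval_rTensor,
    tensorEval_comm] at h
  exact h

theorem pairing_coboundary_right (p q : ℤ) {u : X.C.X p →ₗ[ℤ] R} (hu : u ∈ X.cocycles R p)
    {v : X.C.X q →ₗ[ℤ] R} (hv : v ∈ X.coboundaries R q) : X.cochainPairing 0 p q u v = 0 := by
  obtain ⟨w, rfl⟩ := hv
  have h := X.pairing_zero_relation (p := p) (q := q - 1) (q' := q) rfl (by omega) u w
  rw [LinearMap.mem_ker.mp hu] at h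
  simpa using h

theorem pairing_coboundary_left (p q : ℤ) {u : X.C.X p →ₗ[ℤ] R} (hu : u ∈ X.coboundaries R p)
    {v : X.C.X q →ₗ[ℤ] R} (hv : v ∈ X.cocycles R q) : X.cochainPairing 0 p q u v = 0 := by
  obtain ⟨w, rfl⟩ := hu
  have h := X.pairing_zero_relation (p := p - 1) (p' := p) (q := q) (by omega) rfl w v
  rw [LinearMap.mem_ker.mp hv, map_zero, zero_add, ← Units.smul_def] at h
  exact (smul_eq_zero_iff_eq _).mp h

variable (R)

/-- The pairing `λ : H^p(C; R) × H^q(C; R) → R` induced by `φ_0`. -/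
def cupForm (p q : ℤ) : X.Cohomology R p →ₗ[R] X.Cohomology R q →ₗ[R] R :=
  Submodule.liftQ _
    (LinearMap.flip <| Submodule.liftQ _
      (LinearMap.flip <| (X.cochainPairing 0 p q).domRestrict₁₂ (X.cocycles R p) (X.cocycles R q))
      fun v hv => LinearMap.ext fun u => X.pairing_coboundary_right p q u.2 hv)
    fun u hu => LinearMap.ext fun v => by
      obtain ⟨v, rfl⟩ := Submodule.Quotient.mk_surjective _ v
      exact X.pairing_coboundary_left p q hu v.2

theorem cupForm_mk (p q : ℤ) (u : X.cocycles R p) (v : X.cocycles R q) :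
    X.cupForm R p q (Submodule.Quotient.mk u) (Submodule.Quotient.mk v) =
      X.cochainPairing 0 p q u.1 v.1 := rfl

end SymmetricComplex

/-! ### Forms over `ℤ/2` with enhancements -/

section Forms

variable {V : Type*} [AddCommGroup V] [Module (ZMod 2) V]

/-- `L` is a sublagrangian of the symmetric form `(V, λ)` over `ℤ/2` with `ℤ/4`-valued quadratic
enhancement `q`: both `λ` and `q` vanish on `L`. -/
def IsSublagrangian (lam : LinearMap.BilinForm (ZMod 2) V) (q : V → ZMod 4)
    (L : Submodule (ZMod 2) V) : Prop :=
  (∀ x ∈ L, ∀ y ∈ L, lam x y = 0) ∧ ∀ x ∈ L, q x = 0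

/-- The subquotient `L^⊥ / L` (for `L ⊆ L^⊥`). -/
abbrev PerpQuotient (lam : LinearMap.BilinForm (ZMod 2) V) (L : Submodule (ZMod 2) V) : Type _ :=
  lam.orthogonal L ⧸ L.submoduleOf (lam.orthogonal L)

/-- The Arf invariant of a nonsingular quadratic form over `ℤ/2` on a finite vector space: the value
in `ℤ/2` that the form takes most often. -/
def arfInvariant (h : QuadraticForm (ZMod 2) V) : ZMod 2 :=
  if Nat.card {x : V // h x = 1} < Nat.card {x : V // h x = 0} then 0 else 1

end Forms

/-! ### Signature, Wu class and Pontryagin square of a `4k`-dimensional symmetric complex -/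

namespace SymmetricComplex

variable {k : ℤ} (X : SymmetricComplex.{u} (4 * k))

/-- The signature `σ(C, φ)`: the signature of the form on `H^{2k}(C; ℝ)` induced by `φ_0`. -/
def signature : ℤ :=
  let Q : QuadraticForm ℝ (X.Cohomology ℝ (2 * k)) :=
    LinearMap.BilinMap.toQuadraticMap (X.cupForm ℝ (2 * k) (2 * k))
  (sigPos Q : ℤ) - (sigNeg Q : ℤ)

/-- `H^{2k}(C; ℤ/2)`. -/
abbrev MiddleCohomology : Type u := X.Cohomology (ZMod 2) (2 * k)

/-- The form `λ` on `H^{2k}(C; ℤ/2)` induced by `φ_0`. -/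
abbrev middleForm : LinearMap.BilinForm (ZMod 2) X.MiddleCohomology :=
  X.cupForm (ZMod 2) (2 * k) (2 * k)

/-- `v` is the Wu class `v_{2k} ∈ H^{2k}(C; ℤ/2)`, the class representing the homomorphism
`H^{2k}(C; ℤ/2) → ℤ/2`, `x ↦ φ_0(x, x)`. -/
def IsWuClass (v : X.MiddleCohomology) : Prop :=
  ∀ x, X.middleForm x x = X.middleForm x v

/-- The reduction mod 2 of an integral cochain. -/
def reduceTwo {p : ℤ} (u : X.C.X p →ₗ[ℤ] ℤ) : X.C.X p →ₗ[ℤ] ZMod 2 :=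
  (Int.castAddHom (ZMod 2)).toIntLinearMap ∘ₗ u

/-- The pair `(u, v)` is a chain map from `C` to the complex `ℤ → ℤ` (multiplication by 2, in
degrees `2k + 1` and `2k`), that is `u ∘ d = 2 v`, and it represents the class
`x ∈ H^{2k}(C; ℤ/2)`. -/
def Represents (x : X.MiddleCohomology) (u : X.C.X (2 * k) →ₗ[ℤ] ℤ)
    (v : X.C.X (2 * k + 1) →ₗ[ℤ] ℤ) : Prop :=
  X.coboundary ℤ (2 * k) (2 * k + 1) u = 2 • v ∧
    ∃ hu : X.reduceTwo u ∈ X.cocycles (ZMod 2) (2 * k), x = Submodule.Quotient.mk ⟨_, hu⟩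

/-- The value `φ_0(u, u) + 2 φ_1(v, u) ∈ ℤ/4`. -/
def pontryaginValue (u : X.C.X (2 * k) →ₗ[ℤ] ℤ) (v : X.C.X (2 * k + 1) →ₗ[ℤ] ℤ) : ZMod 4 :=
  ((X.cochainPairing 0 (2 * k) (2 * k) u u +
    2 * X.cochainPairing 1 (2 * k + 1) (2 * k) v u : ℤ) : ZMod 4)

theorem exists_dvd_two {M : Type*} [AddCommGroup M] [Module.Free ℤ M] (f : M →ₗ[ℤ] ℤ)
    (hf : ∀ x, (2 : ℤ) ∣ f x) : ∃ g : M →ₗ[ℤ] ℤ, f = 2 • g := by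
  choose c hc using hf
  let b := Module.Free.chooseBasis ℤ M
  refine ⟨b.constr ℤ fun i => c (b i), b.ext fun i => ?_⟩
  rw [hc (b i)]
  simp

theorem reduceTwo_eq_zero {p : ℤ} {u : X.C.X p →ₗ[ℤ] ℤ} (hu : X.reduceTwo u = 0) :
    ∃ t : X.C.X p →ₗ[ℤ] ℤ, u = 2 • t := by
  have := X.free p
  exact exists_dvd_two u fun x =>
    (ZMod.intCast_zmod_eq_zero_iff_dvd _ 2).mp (LinearMap.congr_fun hu x)

theorem exists_reduceTwo_eq {p : ℤ} (w : X.C.X p →ₗ[ℤ] ZMod 2) :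
    ∃ u : X.C.X p →ₗ[ℤ] ℤ, X.reduceTwo u = w := by
  have := X.free p
  let b := Module.Free.chooseBasis ℤ (X.C.X p)
  choose c hc using fun a : ZMod 2 => ZMod.intCast_surjective a
  refine ⟨b.constr ℤ fun i => c (w (b i)), b.ext fun i => ?_⟩
  simp [reduceTwo, hc]

theorem exists_represents (x : X.MiddleCohomology) : ∃ u v, X.Represents x u v := by
  obtain ⟨⟨w, hw⟩, rfl⟩ := Submodule.Quotient.mk_surjective _ x
  obtain ⟨u, rfl⟩ := X.exists_reduceTwo_eq w
  obtain ⟨v, hv⟩ := X.reduceTwo_eq_zero (u := X.coboundary ℤ (2 * k) (2 * k + 1) u)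
    (LinearMap.mem_ker.mp hw)
  exact ⟨u, v, hv, hw, rfl⟩

theorem pontryaginValue_eq {x : X.MiddleCohomology} {u u' : X.C.X (2 * k) →ₗ[ℤ] ℤ}
    {v v' : X.C.X (2 * k + 1) →ₗ[ℤ] ℤ} (h : X.Represents x u v) (h' : X.Represents x u' v') :
    X.pontryaginValue u v = X.pontryaginValue u' v' := by
  obtain ⟨hv, hu, rfl⟩ := h
  obtain ⟨hv', hu', hx⟩ := h'
  obtain ⟨w₂, hw₂⟩ := (Submodule.Quotient.eq _).mp hx.symm
  obtain ⟨w, rfl⟩ := X.exists_reduceTwo_eq w₂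
  obtain ⟨t, ht⟩ := X.reduceTwo_eq_zero
    (u := u' - u - X.coboundary ℤ (2 * k - 1) (2 * k) w) (LinearMap.ext fun y => by
      have := LinearMap.congr_fun hw₂ y
      simp [reduceTwo, coboundary] at this ⊢
      rw [this]; ring)
  have hdd : ∀ (p q r : ℤ) (f : X.C.X p →ₗ[ℤ] ℤ),
      X.coboundary ℤ q r (X.coboundary ℤ p q f) = 0 := fun p q r f => by
    refine LinearMap.ext fun y => ?_
    have h0 : (X.C.d q p) ((X.C.d r q) y) = 0 := by
      rw [← ConcreteCategory.comp_apply, X.C.d_comp_d]; rfl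
    simp [coboundary, chainD, h0]
  obtain rfl : u' = u + X.coboundary ℤ (2 * k - 1) (2 * k) w + 2 • t := by
    rw [← ht]; abel
  have htwo : ∀ {p : ℤ} (a b : X.C.X p →ₗ[ℤ] ℤ), 2 • a = 2 • b → a = b := fun a b hab =>
    LinearMap.ext fun y => by
      have := LinearMap.congr_fun hab y
      simpa using this
  obtain rfl : v' = v + X.coboundary ℤ (2 * k) (2 * k + 1) t := by
    apply htwo
    rw [← hv', map_add, map_add, hdd, hv, map_nsmul, smul_add, add_zero]
  have hdv : X.coboundary ℤ (2 * k + 1) (2 * k + 1 + 1) v = 0 := by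
    apply htwo
    rw [← map_nsmul, ← hv, hdd, smul_zero]
  have e0 : Even (2 * k) := even_two_mul k
  have o1 : Odd (2 * k - 1) := ⟨k - 1, by ring⟩
  have e1 : (2 * k).negOnePow = 1 := Int.negOnePow_even _ e0
  have e2 : (2 * k - 1).negOnePow = -1 := Int.negOnePow_odd _ o1
  have e3 : (4 * k).negOnePow = 1 := Int.negOnePow_even _ ⟨2 * k, by ring⟩
  have e4 : (2 * k * (2 * k)).negOnePow = 1 := Int.negOnePow_even _ (e0.mul_left _)
  have e5 : ((2 * k + 1) * (2 * k - 1)).negOnePow = -1 :=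
    Int.negOnePow_odd _ (e0.add_one.mul o1)
  have r1 := fun y => X.pairing_zero_relation (p := 2 * k - 1) (p' := 2 * k) (q := 2 * k)
    (q' := 2 * k + 1) (by omega) rfl w y
  have r2 := fun y => X.pairing_zero_relation (p := 2 * k) (p' := 2 * k + 1) (q := 2 * k - 1)
    (q' := 2 * k) rfl (by omega) y w
  have r3 := fun x y => X.pairing_succ_relation (R := ℤ) 0 (p := 2 * k) (p' := 2 * k + 1)
    (q := 2 * k) (q' := 2 * k + 1) rfl rfl x y
  have r4 := X.pairing_succ_relation 0 (p := 2 * k + 1) (p' := 2 * k + 1 + 1)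
    (q := 2 * k - 1) (q' := 2 * k) rfl (by omega) v w
  have a1 := r1 u
  have a2 := r1 (X.coboundary ℤ (2 * k - 1) (2 * k) w)
  have a3 := r2 u
  have a4 := r3 t (X.coboundary ℤ (2 * k - 1) (2 * k) w)
  have a5 := r3 t u
  simp only [hdd, hv, hdv, e1, e2, e3, e4, e5, map_nsmul, map_zero, LinearMap.smul_apply,
    LinearMap.zero_apply, Units.val_one, Units.val_neg, smul_eq_mul, nsmul_eq_mul,
    Nat.cast_ofNat, Nat.cast_zero, zero_add, add_zero, Int.negOnePow_one] at a1 a2 a3 a4 a5 r4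
  rw [pontryaginValue, pontryaginValue]
  apply (ZMod.intCast_eq_intCast_iff_dvd_sub _ _ 4).mpr
  simp only [map_add, LinearMap.add_apply, map_nsmul, LinearMap.smul_apply,
    nsmul_eq_mul, Nat.cast_ofNat]
  omega

/-- The Pontryagin square `P_2 : H^{2k}(C; ℤ/2) → ℤ/4`, `(u, v) ↦ φ_0(u, u) + 2 φ_1(v, u)`.
It does not depend on the representing chain map, see `pontryaginSquare_eq`. -/
def pontryaginSquare (x : X.MiddleCohomology) : ZMod 4 :=
  X.pontryaginValue (X.exists_represents x).choose (X.exists_represents x).choose_spec.choose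

theorem pontryaginSquare_eq {x : X.MiddleCohomology} {u : X.C.X (2 * k) →ₗ[ℤ] ℤ}
    {v : X.C.X (2 * k + 1) →ₗ[ℤ] ℤ} (h : X.Represents x u v) :
    X.pontryaginSquare x = X.pontryaginValue u v :=
  X.pontryaginValue_eq (X.exists_represents x).choose_spec.choose_spec h

end SymmetricComplex

end

noncomputable section

/-! ### The one-variable quadratic Gauss sum with its phase, from the theta function. -/

section GaussSums

open Complex Filter Topology

/-! Everything is read off from the Gauss sum `G = ∑ i ^ P₂(x)` over the finite group `H^{2k}(C;
ℤ/2)`. The key fact (`exists_gaussSum_pontryaginSquare`) is that `G` is a positive multiple of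
`exp(πiσ/4)`, a form of the Milgram–van der Blij formula.

Given this, let `v` be the Wu class. Since `2λ(x, v) = 2λ(x, x) = 2P₂(x)` in `ℤ/4`, one has `P₂(x +
v) = P₂(v) - P₂(x)`, so reindexing gives `G = i ^ P₂(v) · conj G`. Comparing phases yields `P₂(v) =
σ mod 4` (`wuClass_eq`), and `⟨v⟩` is a sublagrangian exactly when `P₂(v) = 0`. In that case
translation by `L` concentrates `G` on `L^⊥`, where `P₂ = 2h` because `λ(x, x) = λ(x, v) = 0`. Hence
`G` is a positive multiple of `∑ (-1) ^ h`, whose sign is that of the majority value of `h`, while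
`exp(πiσ/4) = (-1) ^ (σ/4)`; this is the Arf formula (`signature_eq_arfInvariant`).

The key fact is reached by the same localisation principle (`sum_eq_sum_filter_of_translate`), used
twice. First, `P₂` vanishes on the reductions of integral torsion cocycles, and by duality the
orthogonal complement of these is the image of the integral cocycles; so `G` becomes, up to a
positive factor, the sum of `i ^ S(l, l)` over `(ℤ/4)^m`, where `S` is the unimodular form on
integral cohomology modulo torsion. Second, `S` is diagonalised over `ℚ` with integral diagonal
entries `a_i`, and the Gauss sum of the diagonal form with coefficients `M / a_i` modulo `4M`
localises to a copy of the lattice. That diagonal sum is a product of one-variable sums with phases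
`exp(πi sign(a_i)/4)`, and `∑ sign(a_i)` is the signature.

The one-variable phase comes from evaluating the limit of `√t · θ(1/2m + it)` as `t → 0` in two
ways: by averaging over residue classes, and by the modular transformation of `θ`. -/

theorem hasSum_exp_neg_mul_sq_residue {N : ℕ} (hN : 0 < N) (r : ℕ) {t : ℝ} (ht : 0 < t) :
    HasSum (fun k : ℤ => Real.exp (-Real.pi * ((N * k + r : ℤ) : ℝ) ^ 2 * t))
      (HurwitzZeta.evenKernel ((r / N : ℝ) : UnitAddCircle) (N ^ 2 * t)) := by
  have hN' : (N : ℝ) ≠ 0 := by positivity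
  convert HurwitzZeta.hasSum_int_evenKernel (r / N : ℝ) (t := N ^ 2 * t) (by positivity) using 3
    with k
  push_cast
  field_simp

/-- The functional equation trades the kernel near `0` for `cosKernel` near infinity, which tends to
`1` whatever `a` is. So all residue classes modulo `N` carry the same weight `1 / N`. -/
theorem tendsto_sqrt_mul_evenKernel {N : ℕ} (hN : 0 < N) (a : UnitAddCircle) :
    Tendsto (fun t : ℝ => √t * HurwitzZeta.evenKernel a (N ^ 2 * t)) (𝓝[>] 0) (𝓝 (1 / N)) := by
  obtain ⟨p, hp, h⟩ := HurwitzZeta.isBigO_atTop_cosKernel_sub a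
  have h1 : Tendsto (fun x => HurwitzZeta.cosKernel a x - 1) atTop (𝓝 0) := by
    refine h.trans_tendsto (Real.tendsto_exp_atBot.comp ?_)
    exact tendsto_id.const_mul_atTop_of_neg (neg_lt_zero.mpr hp)
  have h2 : Tendsto (fun x => HurwitzZeta.cosKernel a x) atTop (𝓝 1) := by
    simpa using h1.add_const 1
  have h3 : Tendsto (fun t : ℝ => 1 / ((N : ℝ) ^ 2 * t)) (𝓝[>] 0) atTop := by
    have : Tendsto (fun t : ℝ => (1 / (N : ℝ) ^ 2) * t⁻¹) (𝓝[>] 0) atTop :=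
      tendsto_inv_nhdsGT_zero.const_mul_atTop (by positivity)
    refine this.congr fun t => ?_
    field_simp
  have h4 := (h2.comp h3).const_mul (1 / (N : ℝ))
  rw [mul_one] at h4
  refine h4.congr' ?_
  filter_upwards [self_mem_nhdsWithin] with t ht
  have ht : 0 < t := ht
  have hN' : (0 : ℝ) < N := by positivity
  rw [HurwitzZeta.evenKernel_functional_equation, ← Real.sqrt_eq_rpow,
    Real.sqrt_mul (by positivity), Real.sqrt_sq hN'.le]
  have := Real.sqrt_pos.mpr ht
  simp only [Function.comp]
  field_simp

/-- The Gaussian mean of a periodic function. -/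
theorem tendsto_sqrt_mul_tsum_periodic {N : ℕ} (hN : 0 < N) (f : ℤ → ℂ)
    (hf : ∀ n k : ℤ, f (N * k + n) = f n) :
    Tendsto (fun t : ℝ => (√t : ℂ) * ∑' n : ℤ, f n * Real.exp (-Real.pi * (n : ℝ) ^ 2 * t))
      (𝓝[>] 0) (𝓝 ((∑ j ∈ Finset.range N, f j) / N)) := by
  have key : ∀ t : ℝ, 0 < t → ∑' n : ℤ, f n * Real.exp (-Real.pi * (n : ℝ) ^ 2 * t) =
      ∑ j ∈ Finset.range N,
        f j * (HurwitzZeta.evenKernel ((j / N : ℝ) : UnitAddCircle) (N ^ 2 * t) : ℂ) := by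
    intro t ht
    have : NeZero N := ⟨hN.ne'⟩
    -- Division with remainder splits the sum over `ℤ` into residue classes, on each of which `f` is
    -- constant.
    let e : Fin N × ℤ ≃ ℤ :=
      (Equiv.prodComm _ _).trans (Int.divModEquiv N).symm
    have he : ∀ x, e x = N * x.2 + ((x.1 : ℕ) : ℤ) := fun x => by
      simp [e, Int.divModEquiv]; try ring
    have h1 : ∀ j : Fin N, HasSum (fun k : ℤ => f (e (j, k)) *
        (Real.exp (-Real.pi * ((e (j, k) : ℤ) : ℝ) ^ 2 * t) : ℂ))
        (f (j : ℕ) * (HurwitzZeta.evenKernel (((j : ℕ) / N : ℝ) : UnitAddCircle) (N ^ 2 * t) : ℂ)) := by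
      intro j
      have h := (Complex.hasSum_ofReal.mpr (hasSum_exp_neg_mul_sq_residue hN j ht)).mul_left (f (j : ℕ))
      refine h.congr_fun fun k => ?_
      rw [he, hf]
    rw [Finset.sum_range]
    rw [← e.tsum_eq]
    have hs : Summable fun x : Fin N × ℤ => f (e x) *
        (Real.exp (-Real.pi * ((e x : ℤ) : ℝ) ^ 2 * t) : ℂ) := by
      refine (e.summable_iff (f := fun n : ℤ => f n *
        (Real.exp (-Real.pi * (n : ℝ) ^ 2 * t) : ℂ))).mpr ?_
      have h0 : Summable fun n : ℤ => Real.exp (-Real.pi * (n : ℝ) ^ 2 * t) := by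
        simpa using (HurwitzZeta.hasSum_int_evenKernel 0 ht).summable
      refine Summable.of_norm_bounded (h0.mul_left (∑ j : Fin N, ‖f (j : ℕ)‖)) fun n => ?_
      rw [norm_mul, Complex.norm_real, Real.norm_of_nonneg (Real.exp_pos _).le]
      refine mul_le_mul_of_nonneg_right ?_ (Real.exp_pos _).le
      obtain ⟨⟨j, k⟩, rfl⟩ := e.surjective n
      rw [he, hf]
      exact Finset.single_le_sum (f := fun j : Fin N => ‖f (j : ℕ)‖)
        (fun _ _ => norm_nonneg _) (Finset.mem_univ j)
    rw [hs.tsum_prod, tsum_fintype]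
    exact Finset.sum_congr rfl fun j _ => (h1 j).tsum_eq
  have h2 : Tendsto (fun t : ℝ => ∑ j ∈ Finset.range N, f j *
      ((√t * HurwitzZeta.evenKernel ((j / N : ℝ) : UnitAddCircle) (N ^ 2 * t) : ℝ) : ℂ))
      (𝓝[>] 0) (𝓝 (∑ j ∈ Finset.range N, f j * ((1 / N : ℝ) : ℂ))) :=
    tendsto_finsetSum _ fun j _ => ((Complex.continuous_ofReal.tendsto _).comp
      (tendsto_sqrt_mul_evenKernel hN _)).const_mul _
  rw [Finset.sum_div]
  refine (h2.congr' ?_).trans_eq ?_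
  · filter_upwards [self_mem_nhdsWithin] with t ht
    rw [key t ht, Finset.mul_sum]
    refine Finset.sum_congr rfl fun j _ => ?_
    push_cast; ring
  · congr 1
    refine Finset.sum_congr rfl fun j _ => ?_
    push_cast; ring

theorem jacobiTheta_two_mul_nat_add (m : ℕ) (τ : ℂ) : jacobiTheta (2 * m + τ) = jacobiTheta τ := by
  induction m with
  | zero => simp
  | succ m ih =>
    rw [← ih, ← jacobiTheta_two_add (2 * m + τ)]
    congr 1
    push_cast; ring

theorem jacobiTheta_neg_inv {τ : ℂ} (hτ : 0 < τ.im) :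
    jacobiTheta (-τ⁻¹) = (-I * τ) ^ (1 / 2 : ℂ) * jacobiTheta τ := by
  have h := jacobiTheta_S_smul ⟨τ, hτ⟩
  rw [UpperHalfPlane.modular_S_smul] at h
  simpa [inv_neg] using h

theorem tendsto_jacobiTheta_of_im {α : Type*} {l : Filter α} {g : α → ℂ}
    (hg : Tendsto (fun x => (g x).im) l atTop) : Tendsto (fun x => jacobiTheta (g x)) l (𝓝 1) := by
  have h1 : Tendsto g l (comap im atTop) := tendsto_comap_iff.mpr hg
  have h2 : Tendsto (fun τ : ℂ => Real.exp (-Real.pi * τ.im)) (comap im atTop) (𝓝 0) := by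
    refine (Real.tendsto_exp_atBot.comp
      (tendsto_id.const_mul_atTop_of_neg (neg_lt_zero.mpr Real.pi_pos))).comp tendsto_comap
  have h3 := (isBigO_at_im_infty_jacobiTheta_sub_one.trans_tendsto h2).comp h1
  simpa using h3.add_const 1

/-- A positive factor does not change the argument, so it leaves the principal branch without a
correction; this fixes the phases below. -/
theorem ofReal_mul_cpow_half {r : ℝ} (hr : 0 < r) {z : ℂ} (hz : z ≠ 0) :
    ((r : ℂ) * z) ^ (1 / 2 : ℂ) = (√r : ℂ) * z ^ (1 / 2 : ℂ) := by
  have hr' : (r : ℂ) ≠ 0 := by exact_mod_cast hr.ne'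
  rw [cpow_def_of_ne_zero (mul_ne_zero hr' hz), cpow_def_of_ne_zero hz, log_ofReal_mul hr hz,
    add_mul, Complex.exp_add]
  congr 1
  rw [Real.sqrt_eq_rpow, Real.rpow_def_of_pos hr]
  push_cast
  rfl

/-- The behaviour of the theta function at the cusp `1 / 2m`. -/
theorem tendsto_sqrt_mul_jacobiTheta {m : ℕ} (hm : 0 < m) :
    Tendsto (fun t : ℝ => (√t : ℂ) * jacobiTheta (1 / (2 * m) + I * t)) (𝓝[>] 0)
      (𝓝 (cexp (Real.pi * I / 4) / √(2 * m))) := by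
  have hmR : (0 : ℝ) < m := by exact_mod_cast hm
  have hmC : (m : ℂ) ≠ 0 := by exact_mod_cast hm.ne'
  have hid : Tendsto (fun t : ℝ => t) (𝓝[>] 0) (𝓝 0) := tendsto_id.mono_left nhdsWithin_le_nhds
  let w : ℝ → ℂ := fun t => 1 / (2 * m) + I * t
  have hw : Continuous w := by fun_prop
  have hw0 : w 0 = 1 / (2 * m) := by simp [w]
  have hwim : ∀ t, (w t).im = t := fun t => by
    have : w t = ((1 / (2 * m) : ℝ) : ℂ) + t * I := by simp [w, mul_comm]
    rw [this]; simp
  have hwre : ∀ t, (w t).re = 1 / (2 * m) := fun t => by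
    have : w t = ((1 / (2 * m) : ℝ) : ℂ) + t * I := by simp [w, mul_comm]
    rw [this]; simp
  have hwne : ∀ t, w t ≠ 0 := fun t h => by
    have := hwre t
    rw [h, zero_re] at this
    have : (0 : ℝ) < 1 / (2 * m) := by positivity
    linarith
  -- the image of `w t` under `τ ↦ -1/τ + 2m` is `t * I * u t`
  let u : ℝ → ℂ := fun t => 2 * m / w t
  have hu : ∀ t, u t ≠ 0 := fun t => div_ne_zero (by simp [hmC]) (hwne t)
  have hrel : ∀ t : ℝ, 2 * m + -(w t)⁻¹ = I * (t * u t) := fun t => by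
    have h := hwne t
    simp only [u]
    field_simp
    simp only [w]
    field_simp
    ring
  -- A second inversion sends the point to one whose imaginary part `1 / (4 m² t)` tends to
  -- infinity, where `θ → 1`. Two inversions and the period `2` therefore carry the cusp `1 / 2m` to
  -- infinity.
  have hrel2 : ∀ t : ℝ, 0 < t → -(I * (t * u t))⁻¹ = I / (4 * m ^ 2 * t) - 1 / (2 * m) := by
    intro t ht
    have ht' : (t : ℂ) ≠ 0 := by exact_mod_cast ht.ne'
    have h := hwne t
    have h' : I * (t * u t) ≠ 0 := mul_ne_zero I_ne_zero (mul_ne_zero ht' (hu t))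
    rw [neg_eq_iff_eq_neg]
    refine inv_eq_of_mul_eq_one_left ?_
    simp only [u]
    field_simp
    simp only [w]
    field_simp
    ring_nf
    simp only [I_sq]
    ring
  have heq : ∀ t : ℝ, 0 < t → (√t : ℂ) * jacobiTheta (w t) =
      jacobiTheta (I / (4 * m ^ 2 * t) - 1 / (2 * m)) /
        ((u t) ^ (1 / 2 : ℂ) * (-I * w t) ^ (1 / 2 : ℂ)) := by
    intro t ht
    have ht' : (t : ℂ) ≠ 0 := by exact_mod_cast ht.ne'
    have e1 := jacobiTheta_neg_inv (τ := w t) (by rw [hwim]; exact ht)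
    have him : 0 < (I * (t * u t)).im := by
      rw [← hrel]
      have : (2 * m + -(w t)⁻¹ : ℂ).im = (w t).im / normSq (w t) := by
        simp [Complex.inv_im, neg_div]
      rw [this, hwim]
      exact div_pos ht (normSq_pos.mpr (hwne t))
    have e2 := jacobiTheta_neg_inv him
    rw [hrel2 t ht, ← hrel, jacobiTheta_two_mul_nat_add, e1, hrel, ← mul_assoc (-I) I,
      neg_mul, I_mul_I, neg_neg, one_mul, ofReal_mul_cpow_half ht (hu t)] at e2
    have n1 : (u t) ^ (1 / 2 : ℂ) ≠ 0 := by simp [cpow_eq_zero_iff, hu t]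
    have n2 : (-I * w t) ^ (1 / 2 : ℂ) ≠ 0 := by simp [cpow_eq_zero_iff, hwne t]
    rw [e2, eq_div_iff (mul_ne_zero n1 n2)]
    ring
  have t1 : Tendsto (fun t : ℝ => jacobiTheta (I / (4 * m ^ 2 * t) - 1 / (2 * m))) (𝓝[>] 0)
      (𝓝 1) := by
    apply tendsto_jacobiTheta_of_im
    have : Tendsto (fun t : ℝ => (1 / (4 * (m : ℝ) ^ 2)) * t⁻¹) (𝓝[>] 0) atTop :=
      tendsto_inv_nhdsGT_zero.const_mul_atTop (by positivity)
    refine this.congr fun t => ?_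
    have : (I / (4 * m ^ 2 * t) - 1 / (2 * m) : ℂ) =
        (((1 / (4 * (m : ℝ) ^ 2)) * t⁻¹ : ℝ) : ℂ) * I - ((1 / (2 * m) : ℝ) : ℂ) := by
      push_cast
      rcases eq_or_ne (t : ℂ) 0 with h | h
      · simp [h]
      · field_simp
    rw [this]
    simp only [sub_im, mul_im, ofReal_re, ofReal_im, I_re, I_im]
    ring
  have t2 : Tendsto (fun t : ℝ => (u t) ^ (1 / 2 : ℂ)) (𝓝[>] 0) (𝓝 ((u 0) ^ (1 / 2 : ℂ))) := by
    have hc : ContinuousAt u 0 := by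
      exact ContinuousAt.div continuousAt_const hw.continuousAt (hwne 0)
    have h0 : u 0 = ((4 * m ^ 2 : ℝ) : ℂ) := by
      simp only [u, hw0]; push_cast; field_simp; ring
    have hs : u 0 ∈ slitPlane := by
      rw [h0, ofReal_mem_slitPlane]; positivity
    exact ((continuousAt_cpow_const hs).comp hc).tendsto.mono_left nhdsWithin_le_nhds
  have t3 : Tendsto (fun t : ℝ => (-I * w t) ^ (1 / 2 : ℂ)) (𝓝[>] 0)
      (𝓝 ((-I * w 0) ^ (1 / 2 : ℂ))) := by
    have hc : ContinuousAt (fun t => -I * w t) 0 := (continuous_const.mul hw).continuousAt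
    have hs : -I * w 0 ∈ slitPlane := by
      right
      rw [hw0]
      have : (-I * (1 / (2 * m)) : ℂ) = ((-(1 / (2 * m)) : ℝ) : ℂ) * I := by push_cast; ring
      rw [this, im_ofReal_mul]
      simp [hm.ne']
    exact ((continuousAt_cpow_const hs).comp (f := fun t => -I * w t) hc).tendsto.mono_left
      nhdsWithin_le_nhds
  have v1 : (u 0) ^ (1 / 2 : ℂ) = 2 * m := by
    have h0 : u 0 = ((4 * m ^ 2 : ℝ) : ℂ) * 1 := by
      simp only [u, hw0]; push_cast; field_simp; ring
    rw [h0, ofReal_mul_cpow_half (by positivity) one_ne_zero, one_cpow, mul_one]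
    rw [show (4 * m ^ 2 : ℝ) = (2 * m) ^ 2 by ring, Real.sqrt_sq (by positivity)]
    push_cast; ring
  -- The eighth root of unity in the Gauss sum arises here, as the principal square root of `-I`.
  have v2 : (-I * w 0) ^ (1 / 2 : ℂ) = (√(2 * m) : ℂ)⁻¹ * cexp (-(Real.pi * I / 4)) := by
    have h0 : -I * w 0 = ((1 / (2 * m) : ℝ) : ℂ) * (-I) := by
      rw [hw0]; push_cast; ring
    rw [h0, ofReal_mul_cpow_half (by positivity) (by simp), cpow_def_of_ne_zero (by simp),
      log_neg_I]
    congr 1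
    · rw [one_div, Real.sqrt_inv]; push_cast; rfl
    · congr 1; ring
  have h := t1.div (t2.mul t3) (by
    rw [v1, v2]
    simp [hm.ne', Complex.exp_ne_zero])
  have hval : (1 : ℂ) / ((u 0) ^ (1 / 2 : ℂ) * (-I * w 0) ^ (1 / 2 : ℂ)) =
      cexp (Real.pi * I / 4) / √(2 * m) := by
    rw [v1, v2, Complex.exp_neg]
    have hpos : (0 : ℝ) < 2 * m := by positivity
    have hs : (√(2 * m) : ℂ) ≠ 0 := by
      exact_mod_cast (Real.sqrt_pos.mpr hpos).ne'
    have hsq : (√(2 * m) : ℂ) * √(2 * m) = 2 * m := by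
      exact_mod_cast Real.mul_self_sqrt hpos.le
    have := Complex.exp_ne_zero (Real.pi * I / 4)
    field_simp
    rw [← hsq]; ring
  rw [hval] at h
  refine h.congr' ?_
  filter_upwards [self_mem_nhdsWithin] with t ht
  exact (heq t ht).symm

/-- The quadratic Gauss sum, including its sign. -/
theorem sum_range_cexp_sq_div {m N : ℕ} (hm : 0 < m) (hN : 0 < N) (h : 2 * m ∣ N) :
    ∑ j ∈ Finset.range N, cexp (Real.pi * I * (j : ℂ) ^ 2 / (2 * m)) =
      (N / √(2 * m) : ℝ) * cexp (Real.pi * I / 4) := by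
  have hmC : (m : ℂ) ≠ 0 := by exact_mod_cast hm.ne'
  obtain ⟨c, rfl⟩ := h
  -- The coefficients of `θ(1/2m + it)` as a series in `exp(-πn²t)` have period `N` in `n`, because
  -- `2m ∣ N`; the averaging limit computed here must agree with the limit at the cusp.
  have h1 := tendsto_sqrt_mul_tsum_periodic hN
    (fun n : ℤ => cexp (Real.pi * I * (n : ℂ) ^ 2 / (2 * m))) (fun n k => by
      rw [Complex.exp_eq_exp_iff_exists_int]
      refine ⟨m * c ^ 2 * k ^ 2 + c * k * n, ?_⟩
      push_cast
      field_simp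
      ring)
  have h2 := (tendsto_sqrt_mul_jacobiTheta hm).congr (f₂ := fun t : ℝ => (√t : ℂ) * ∑' n : ℤ,
      cexp (Real.pi * I * (n : ℂ) ^ 2 / (2 * m)) * Real.exp (-Real.pi * (n : ℝ) ^ 2 * t)) (by
    intro t
    rw [jacobiTheta]
    congr 1
    refine tsum_congr fun n => ?_
    push_cast
    rw [← Complex.exp_add]
    congr 1
    linear_combination (-Real.pi * (n : ℂ) ^ 2 * t : ℂ) * (-1 : ℂ) * I_sq)
  have h3 := tendsto_nhds_unique h1 h2
  have hNC : ((2 * m * c : ℕ) : ℂ) ≠ 0 := by exact_mod_cast hN.ne'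
  rw [div_eq_iff hNC] at h3
  simp only [Int.cast_natCast] at h3
  rw [h3]
  push_cast
  ring

end GaussSums

/-! ### Localisation of sums over finite abelian groups. -/

section FiniteSums

/-- Summation over a finite group of a function that transforms by a character `χ x` under
translation of `x` by the image of `φ` localises at the `x` with `χ x` trivial. -/
theorem sum_eq_sum_filter_of_translate {D E : Type*} [AddCommGroup D] [Fintype D] [AddCommGroup E]
    [Fintype E] (φ : E → D) (e : D → ℂ) (χ : D → AddChar E ℂ)
    (h : ∀ x a, e (x + φ a) = e x * χ x a) [DecidablePred fun x => ∀ a, χ x a = 1] :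
    ∑ x, e x = ∑ x with ∀ a, χ x a = 1, e x := by
  classical
  have h1 : (Fintype.card E : ℂ) * ∑ x, e x =
      (Fintype.card E : ℂ) * ∑ x with ∀ a, χ x a = 1, e x := by
    -- Averaging over all translates replaces `χ x` by its sum over `E`, which is `|E|` or `0`
    -- according as the character is trivial or not.
    calc (Fintype.card E : ℂ) * ∑ x, e x = ∑ _a : E, ∑ x, e x := by simp
      _ = ∑ a : E, ∑ x, e (x + φ a) :=
        Finset.sum_congr rfl fun a _ => (Equiv.sum_comp (Equiv.addRight (φ a)) e).symm
      _ = ∑ x, e x * ∑ a, χ x a := by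
        rw [Finset.sum_comm]
        simp_rw [h, Finset.mul_sum]
      _ = ∑ x, if ∀ a, χ x a = 1 then (Fintype.card E : ℂ) * e x else 0 := by
        refine Finset.sum_congr rfl fun x _ => ?_
        rw [AddChar.sum_eq_ite]
        have : χ x = 0 ↔ ∀ a, χ x a = 1 := by
          rw [DFunLike.ext_iff]; simp
        simp only [this]
        split_ifs <;> ring
      _ = _ := by rw [← Finset.sum_filter, Finset.mul_sum]
  exact mul_left_cancel₀ (by simp [Fintype.card_ne_zero]) h1

/-- The nonempty fibres are cosets of the kernel, so `K` is its order. Only positivity of `K`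
matters later, since only phases are compared. -/
theorem exists_sum_comp_eq_mul_sum_range {G H : Type*} [AddGroup G] [AddGroup H] [Fintype G]
    [Fintype H] (φ : G →+ H) [DecidablePred fun y => ∃ x, φ x = y] :
    ∃ K : ℕ, 0 < K ∧ ∀ f : H → ℂ, ∑ x, f (φ x) = K * ∑ y with ∃ x, φ x = y, f y := by
  classical
  refine ⟨(Finset.univ.filter fun x => φ x = 0).card,
    Finset.card_pos.mpr ⟨0, by simp⟩, fun f => ?_⟩
  rw [Finset.mul_sum, ← Finset.sum_fiberwise_of_maps_to (s := Finset.univ)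
    (t := Finset.univ.filter fun y => ∃ x, φ x = y) (g := φ) (by simp)]
  refine Finset.sum_congr rfl fun y hy => ?_
  obtain ⟨x, rfl⟩ := (Finset.mem_filter.mp hy).2
  rw [Finset.sum_congr rfl (g := fun _ => f (φ x)) fun z hz => by rw [(Finset.mem_filter.mp hz).2],
    Finset.sum_const, nsmul_eq_mul]
  congr 2
  refine Finset.card_bij (fun z _ => z - x) (fun z hz => ?_) (fun z _ w _ h => by simpa using h)
    fun w hw => ⟨w + x, ?_, by simp⟩
  · simpa [sub_eq_zero] using hz
  · simpa using hw

end FiniteSums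

theorem addChar_sum_eq_prod {A R ι : Type*} [AddCommMonoid A] [CommMonoid R] (ψ : AddChar A R)
    (s : Finset ι) (f : ι → A) : ψ (∑ i ∈ s, f i) = ∏ i ∈ s, ψ (f i) := by
  classical
  induction s using Finset.induction_on with
  | empty => simp
  | insert i s hi ih => rw [Finset.sum_insert hi, Finset.prod_insert hi, ψ.map_add_eq_mul, ih]

/-! ### Gauss sums of unimodular lattices. -/

section LatticeGaussSum

open Complex Matrix

/-- As `k / 4M = 1 / 4a`, this is the one-variable sum for `m = |a|`; a negative `a` gives the
complex conjugate, hence the sign in the exponent. -/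
theorem exists_pos_sum_zmod_cexp {M : ℕ} [NeZero (4 * M)] {a k : ℤ} (hM : 0 < M)
    (hk : k * a = M) :
    ∃ c : ℝ, 0 < c ∧ ∑ y : ZMod (4 * M), ZMod.stdAddChar ((k : ZMod (4 * M)) * y ^ 2) =
      c * cexp (Real.pi * I / 4 * a.sign) := by
  have ha : a ≠ 0 := by rintro rfl; simp at hk; omega
  have hm : 0 < a.natAbs := Int.natAbs_pos.mpr ha
  have hdvd : 2 * a.natAbs ∣ 4 * M := by
    have : a.natAbs ∣ M := by
      rw [← Int.natCast_dvd_natCast, Int.natAbs_dvd]; exact ⟨k, by rw [← hk]; ring⟩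
    exact mul_dvd_mul (by norm_num) this
  have hsum : ∑ y : ZMod (4 * M), ZMod.stdAddChar ((k : ZMod (4 * M)) * y ^ 2) =
      ∑ j ∈ Finset.range (4 * M), cexp (Real.pi * I * (j : ℂ) ^ 2 / (2 * a)) := by
    symm
    refine Finset.sum_bij' (fun j _ => (j : ZMod (4 * M))) (fun y _ => y.val) (by simp)
      (fun y _ => by simpa using ZMod.val_lt y)
      (fun j hj => ZMod.val_cast_of_lt (Finset.mem_range.mp hj)) (by simp) fun j _ => ?_
    have : ((k : ZMod (4 * M)) * (j : ZMod (4 * M)) ^ 2) = ((k * j ^ 2 : ℤ) : ZMod (4 * M)) := by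
      push_cast; rfl
    rw [this, ZMod.stdAddChar_coe]
    congr 1
    have haC : (a : ℂ) ≠ 0 := by exact_mod_cast ha
    have hMC : (M : ℂ) ≠ 0 := by exact_mod_cast hM.ne'
    have hkC : (k : ℂ) * a = M := by exact_mod_cast hk
    push_cast
    field_simp
    rw [← hkC]; ring
  have hmain := sum_range_cexp_sq_div hm (by omega) hdvd
  have hpos : 0 < ((4 * M : ℕ) : ℝ) / √(2 * a.natAbs) := by
    have : (0 : ℝ) < a.natAbs := by exact_mod_cast hm
    have : (0 : ℝ) < M := by exact_mod_cast hM
    push_cast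
    positivity
  refine ⟨_, hpos, ?_⟩
  rw [hsum]
  rcases ha.lt_or_gt with h | h
  · have hab : (a : ℂ) = -(a.natAbs : ℂ) := by
      have : a = -(a.natAbs : ℤ) := by omega
      exact_mod_cast congrArg (Int.cast : ℤ → ℂ) this
    have h2 := congrArg (starRingEnd ℂ) hmain
    rw [map_sum, map_mul, Complex.conj_ofReal, ← Complex.exp_conj] at h2
    rw [Int.sign_eq_neg_one_of_neg h]
    convert h2 using 2 with j
    · rw [← Complex.exp_conj]
      congr 1
      rw [hab]
      simp [neg_div, div_neg, map_ofNat]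
    · congr 1
      simp [neg_div, map_ofNat]
  · have hab : (a : ℂ) = (a.natAbs : ℂ) := by
      have : a = (a.natAbs : ℤ) := by omega
      rw [← Int.cast_natCast, ← this]
    rw [Int.sign_eq_one_of_pos h, hab, hmain]
    simp

theorem dotProduct_transpose_mul_diagonal_mul {n R : Type*} [Fintype n] [DecidableEq n]
    [CommRing R] (A : Matrix n n R) (k x y : n → R) :
    x ⬝ᵥ (Aᵀ * diagonal k * A) *ᵥ y = ∑ i, k i * ((A *ᵥ x) i * (A *ᵥ y) i) := by
  rw [← mulVec_mulVec, ← mulVec_mulVec, dotProduct_mulVec, vecMul_transpose]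
  simp only [dotProduct, mulVec_diagonal]
  exact Finset.sum_congr rfl fun i _ => by ring

/-- Over `ℚ`, `M⁻¹ • A` is a one-sided and hence two-sided inverse of `B`. -/
theorem mul_eq_smul_one_comm {n : Type*} [Fintype n] [DecidableEq n] {A B : Matrix n n ℤ} {M : ℤ}
    (hM : M ≠ 0) (h : A * B = M • 1) : B * A = M • 1 := by
  let f : Matrix n n ℤ →+* Matrix n n ℚ := (Int.castRingHom ℚ).mapMatrix
  have hf : Function.Injective f := by
    intro A B hAB
    ext i j
    have := congrFun (congrFun hAB i) j
    simpa [f] using this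
  apply hf
  have hMQ : (M : ℚ) ≠ 0 := by exact_mod_cast hM
  have hfM : f (M • (1 : Matrix n n ℤ)) = (M : ℚ) • (1 : Matrix n n ℚ) := by
    rw [map_zsmul, map_one, Int.cast_smul_eq_zsmul]
  have h2 := congrArg f h
  rw [hfM, map_mul] at h2
  have h3 : ((M : ℚ)⁻¹ • f A) * f B = 1 := by
    rw [smul_mul_assoc, h2, smul_smul, inv_mul_cancel₀ hMQ, one_smul]
  have h4 := mul_eq_one_comm.mp h3
  rw [hfM, map_mul]
  rwa [mul_smul_comm, inv_smul_eq_iff₀ hMQ] at h4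

theorem mul_mul_eq_smul_one_of_transpose_mul {n : Type*} [Fintype n] [DecidableEq n]
    {S S' R K : Matrix n n ℤ} {M : ℤ} (hM : M ≠ 0) (hS : S * S' = 1)
    (hR : Rᵀ * K * R = M • S) : R * (S' * (Rᵀ * K)) = M • 1 := by
  refine mul_eq_smul_one_comm hM ?_
  rw [mul_assoc, hR, mul_smul_comm, mul_eq_one_comm.mp hS]

/-- The Gauss sum of a unimodular lattice that is diagonal over `ℚ`. -/
theorem exists_pos_sum_stdAddChar_unimodular {n : ℕ} (S S' R : Matrix (Fin n) (Fin n) ℤ)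
    (a k : Fin n → ℤ) (M : ℕ) (hM : 0 < M) (hk : ∀ i, k i * a i = M) (hS : S * S' = 1)
    (hR : Rᵀ * diagonal k * R = (M : ℤ) • S) :
    ∃ c : ℝ, 0 < c ∧ ∑ l : Fin n → ZMod 4,
      ZMod.stdAddChar (l ⬝ᵥ (S.map (Int.cast : ℤ → ZMod 4)) *ᵥ l) =
        c * cexp (Real.pi * I / 4 * (∑ i, (a i).sign : ℤ)) := by
  classical
  have : NeZero (4 * M) := ⟨by omega⟩
  let r : ℤ →+* ZMod (4 * M) := Int.castRingHom _
  let k' : Fin n → ZMod (4 * M) := fun i => k i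
  let R' := R.map r
  have hR' : R'ᵀ * diagonal k' * R' = (M : ZMod (4 * M)) • S.map r := by
    have := congrArg (fun A => A.map r) hR
    simp only [Matrix.map_mul, transpose_map] at this
    convert this using 1
    · rw [diagonal_map (map_zero r)]; rfl
    · ext i j
      change (M : ZMod (4 * M)) * r (S i j) = r ((M : ℤ) * S i j)
      simp [r]
  have hquad : ∀ x y : Fin n → ZMod (4 * M),
      ∑ i, k' i * ((R' *ᵥ x) i * (R' *ᵥ y) i) = M * (x ⬝ᵥ S.map r *ᵥ y) := fun x y => by
    rw [← dotProduct_transpose_mul_diagonal_mul, hR', smul_mulVec, dotProduct_smul, smul_eq_mul]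
  have h4M : (4 : ZMod (4 * M)) * M = 0 := by
    exact_mod_cast ZMod.natCast_self (4 * M)
  let E : (Fin n → ZMod (4 * M)) → ℂ := fun y => ZMod.stdAddChar (∑ i, k' i * y i ^ 2)
  let L : (Fin n → ZMod (4 * M)) → (Fin n → ZMod (4 * M)) →+ ZMod (4 * M) := fun y =>
    { toFun := fun l => ∑ i, 4 * k' i * (y i * (R' *ᵥ l) i)
      map_zero' := by simp
      map_add' := fun l l' => by simp [mulVec_add, mul_add, Finset.sum_add_distrib] }
  -- The translation by `2 R l` is chosen so that the quadratic term is `4M · S(l, l) = 0` modulo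
  -- `4M`, leaving only the cross term, a character of `l`.
  have hE : ∀ y l, E (y + 2 • (R' *ᵥ l)) =
      E y * (ZMod.stdAddChar.compAddMonoidHom (L y) : AddChar _ ℂ) l := by
    intro y l
    simp only [E, L, AddChar.compAddMonoidHom_apply, AddMonoidHom.coe_mk, ZeroHom.coe_mk]
    rw [← AddChar.map_add_eq_mul]
    congr 1
    have h0 : 4 * ∑ i, k' i * ((R' *ᵥ l) i * (R' *ᵥ l) i) = 0 := by
      rw [hquad, ← mul_assoc, h4M, zero_mul]
    rw [← sub_eq_zero, ← h0, Finset.mul_sum, ← Finset.sum_add_distrib, ← Finset.sum_sub_distrib]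
    refine Finset.sum_congr rfl fun i _ => ?_
    rw [Pi.add_apply, Pi.smul_apply, nsmul_eq_mul]
    push_cast
    ring
  have hperp : ∀ y, (∀ l, (ZMod.stdAddChar.compAddMonoidHom (L y) : AddChar _ ℂ) l = 1) ↔
      ∃ l, (mulVecLin R').toAddMonoidHom l = y := by
    intro y
    have hinj : ∀ l, (ZMod.stdAddChar.compAddMonoidHom (L y) : AddChar _ ℂ) l = 1 ↔ L y l = 0 := by
      intro l
      rw [AddChar.compAddMonoidHom_apply, ← AddChar.map_zero_eq_one (ZMod.stdAddChar (N := 4 * M)),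
        ZMod.injective_stdAddChar.eq_iff]
    simp only [hinj]
    constructor
    · intro h
      let Y : Fin n → ℤ := fun i => (y i).val
      have hY : ∀ i, ((Y i : ℤ) : ZMod (4 * M)) = y i := fun i => by simp [Y]
      -- Testing the character on basis vectors gives `4M ∣ 4 (RᵀKY)_j`. With `w = RᵀKY / M`, the
      -- identity `R S' RᵀK = M` then gives `Y = R S' w`; this is where unimodularity enters.
      have hw : ∀ j, (M : ℤ) ∣ ((Rᵀ * diagonal k) *ᵥ Y) j := by
        intro j
        have h1 := h (Pi.single j 1)
        have h2 : L y (Pi.single j 1) = ((4 * ((Rᵀ * diagonal k) *ᵥ Y) j : ℤ) : ZMod (4 * M)) := by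
          simp only [L, AddMonoidHom.coe_mk, ZeroHom.coe_mk, mulVec_single_one, ← mulVec_mulVec]
          simp only [mulVec, dotProduct, transpose_apply, diagonal_apply, R', k', col_apply,
            map_apply, ite_mul, zero_mul, Finset.sum_ite_eq, Finset.mem_univ, if_true]
          push_cast
          simp only [hY, Finset.mul_sum]
          refine Finset.sum_congr rfl fun i _ => ?_
          simp [r]; ring
        rw [h2, ZMod.intCast_zmod_eq_zero_iff_dvd] at h1
        push_cast at h1
        exact (mul_dvd_mul_iff_left (by norm_num : (4 : ℤ) ≠ 0)).mp h1
      choose w hw using hw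
      have hRl : R *ᵥ (S' *ᵥ w) = Y := by
        have h1 : (Rᵀ * diagonal k) *ᵥ Y = (M : ℤ) • w := funext fun j => by simp [hw j]
        have h2 := congrArg (fun v => R *ᵥ (S' *ᵥ v)) h1
        simp only [mulVec_mulVec, mulVec_smul] at h2
        rw [mul_mul_eq_smul_one_of_transpose_mul (by exact_mod_cast hM.ne') hS hR,
          smul_mulVec, one_mulVec] at h2
        rw [mulVec_mulVec]
        exact (smul_right_injective _ (by exact_mod_cast hM.ne' : (M : ℤ) ≠ 0) h2).symm
      refine ⟨fun i => r ((S' *ᵥ w) i), funext fun i => ?_⟩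
      have := congrArg r (congrFun hRl i)
      rw [RingHom.map_mulVec] at this
      rw [← hY i]
      exact this
    · rintro ⟨x, rfl⟩ l
      have : L ((mulVecLin R').toAddMonoidHom x) l =
          4 * ∑ i, k' i * ((R' *ᵥ x) i * (R' *ᵥ l) i) := by
        simp only [L, AddMonoidHom.coe_mk, ZeroHom.coe_mk, Finset.mul_sum]
        exact Finset.sum_congr rfl fun i _ => by
          simp [mul_assoc]
      rw [this, hquad, ← mul_assoc, h4M, zero_mul]
  have hsum1 := sum_eq_sum_filter_of_translate (fun l => 2 • (R' *ᵥ l)) E _ hE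
  simp only [hperp] at hsum1
  obtain ⟨K, hK, hsum2⟩ := exists_sum_comp_eq_mul_sum_range (mulVecLin R').toAddMonoidHom
  have hsum2 := hsum2 E
  rw [← hsum1] at hsum2
  let π : ZMod (4 * M) →+* ZMod 4 := ZMod.castHom (Dvd.intro _ rfl) _
  let π' : (Fin n → ZMod (4 * M)) →+ (Fin n → ZMod 4) := (π : ZMod (4 * M) →+ ZMod 4).compLeft _
  have hπ' : Function.Surjective π' := by
    intro y
    choose x hx using fun i => ZMod.castHom_surjective (Dvd.intro M rfl : 4 ∣ 4 * M) (y i)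
    exact ⟨x, funext hx⟩
  obtain ⟨K', hK', hsum3⟩ := exists_sum_comp_eq_mul_sum_range π'
  have hsum3 := hsum3 fun l => ZMod.stdAddChar (l ⬝ᵥ (S.map (Int.cast : ℤ → ZMod 4)) *ᵥ l)
  rw [Finset.filter_true_of_mem fun y _ => hπ' y] at hsum3
  -- On the image of `R` the exponent is `M · S(l, l)` over `4M`, so it depends only on `S(l, l)`
  -- modulo `4`.
  have hEl : ∀ l, E ((mulVecLin R').toAddMonoidHom l) =
      ZMod.stdAddChar (π' l ⬝ᵥ (S.map (Int.cast : ℤ → ZMod 4)) *ᵥ π' l) := by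
    intro l
    have h1 : ∑ i, k' i * ((R' *ᵥ l) i) ^ 2 = M * (l ⬝ᵥ S.map r *ᵥ l) := by
      rw [← hquad]; exact Finset.sum_congr rfl fun i _ => by ring
    have h2 : π' l ⬝ᵥ (S.map (Int.cast : ℤ → ZMod 4)) *ᵥ π' l = π (l ⬝ᵥ S.map r *ᵥ l) := by
      simp [π', dotProduct, mulVec, r]
    have h3 : ∀ x : ZMod (4 * M), ZMod.stdAddChar ((M : ZMod (4 * M)) * x) =
        ZMod.stdAddChar (π x) := by
      intro x
      obtain ⟨x, rfl⟩ := ZMod.intCast_surjective x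
      rw [map_intCast, show (M : ZMod (4 * M)) * (x : ZMod (4 * M)) = ((M * x : ℤ) : ZMod (4 * M)) by
        push_cast; rfl, ZMod.stdAddChar_coe, ZMod.stdAddChar_coe]
      congr 1
      have hMC : (M : ℂ) ≠ 0 := by exact_mod_cast hM.ne'
      push_cast
      field_simp
    rw [h2, ← h3, ← h1]
    rfl
  simp only [hEl] at hsum2
  rw [hsum3] at hsum2
  choose c hc hcs using fun i => exists_pos_sum_zmod_cexp hM (hk i)
  -- The diagonal sum factors over the coordinates, and the phases add up to the sum of signs.
  have hprod : ∑ y, E y = (∏ i, c i : ℝ) * cexp (Real.pi * I / 4 * (∑ i, (a i).sign : ℤ)) := by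
    have h1 : ∀ y, E y = ∏ i, ZMod.stdAddChar (k' i * y i ^ 2) := fun y => by
      simp only [E]
      exact addChar_sum_eq_prod _ _ _
    simp only [h1]
    rw [← Fintype.prod_sum fun i (y : ZMod (4 * M)) => (ZMod.stdAddChar (k' i * y ^ 2) : ℂ)]
    rw [Finset.prod_congr rfl fun i _ => hcs i, Finset.prod_mul_distrib, ← Complex.exp_sum]
    push_cast
    rw [Finset.mul_sum]
  rw [hprod] at hsum2
  have hc' : 0 < ∏ i, c i := Finset.prod_pos fun i _ => hc i
  refine ⟨K * (∏ i, c i) / K', by positivity, ?_⟩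
  have : (K' : ℂ) ≠ 0 := by exact_mod_cast hK'.ne'
  rw [mul_comm, ← eq_div_iff this] at hsum2
  rw [hsum2]
  push_cast
  ring

end LatticeGaussSum

/-! ### Diagonalisation over `ℚ` with cleared denominators. -/

section Diagonalization

open Matrix

/-- An orthogonal `ℚ`-basis is scaled to be integral. Taking `M = ∏ |a_i|` makes `k_i = M / a_i`
integral, and the last identity is `diag(k) · PᵀSP = M` with the factors cyclically rearranged. -/
theorem exists_int_diagonalization {n : ℕ} (S : Matrix (Fin n) (Fin n) ℤ) (hS : S.IsSymm)
    (hdet : S.det ≠ 0) :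
    ∃ (P : Matrix (Fin n) (Fin n) ℤ) (a k : Fin n → ℤ) (M : ℕ), 0 < M ∧
      (∀ i, k i * a i = M) ∧ Pᵀ * S * P = diagonal a ∧
      P * (diagonal k * (Pᵀ * S)) = (M : ℤ) • 1 := by
  let f : ℤ →+* ℚ := Int.castRingHom ℚ
  let B : LinearMap.BilinForm ℚ (Fin n → ℚ) := Matrix.toBilin' (S.map f)
  have hB : B.IsSymm := by
    rw [LinearMap.BilinForm.isSymm_iff_basis (Pi.basisFun ℚ (Fin n))]
    intro i j
    simp only [B, Pi.basisFun_apply, Matrix.toBilin'_single, map_apply]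
    rw [hS.apply]
  have : Invertible (2 : ℚ) := invertibleOfNonzero two_ne_zero
  obtain ⟨v₀, hv₀⟩ := LinearMap.BilinForm.exists_orthogonal_basis (B := B) ⟨fun x y => hB.eq x y⟩
  let v : Module.Basis (Fin n) ℚ (Fin n → ℚ) := v₀.reindex (finCongr (by simp))
  have hv : ∀ i j, i ≠ j → B (v i) (v j) = 0 := fun i j hij => by
    simp only [v, Module.Basis.reindex_apply]
    exact hv₀ (fun h => hij ((finCongr _).symm.injective h))
  obtain ⟨d, hd⟩ := IsLocalization.exist_integer_multiples_of_finite (nonZeroDivisors ℤ)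
    (fun x : Fin n × Fin n => v x.2 x.1)
  choose p hp using hd
  have hd0 : (d : ℤ) ≠ 0 := nonZeroDivisors.coe_ne_zero d
  let P : Matrix (Fin n) (Fin n) ℤ := fun i j => p (i, j)
  have hP : P.map f = ((d : ℤ) : ℚ) • (Pi.basisFun ℚ (Fin n)).toMatrix v := by
    ext i j
    change (p (i, j) : ℚ) = (d : ℤ) * v j i
    rw [← zsmul_eq_mul]
    exact hp (i, j)
  have hdetP : P.det ≠ 0 := by
    intro h
    have h1 : (P.map f).det = 0 := by
      have := f.map_det P
      rw [h, map_zero] at this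
      exact this.symm
    rw [hP, det_smul] at h1
    have := (Module.Basis.invertibleToMatrix (Pi.basisFun ℚ (Fin n)) v)
    have h2 := (Matrix.isUnit_det_of_invertible ((Pi.basisFun ℚ (Fin n)).toMatrix v)).ne_zero
    have h3 : (((d : ℤ) : ℚ)) ≠ 0 := by exact_mod_cast hd0
    simp [h2, h3] at h1
  let a : Fin n → ℤ := fun i => (Pᵀ * S * P) i i
  have hdiag : Pᵀ * S * P = diagonal a := by
    ext i j
    rcases eq_or_ne i j with rfl | hij
    · simp [a]
    · rw [diagonal_apply_ne _ hij]
      have h1 : f ((Pᵀ * S * P) i j) = ((d : ℤ) : ℚ) * ((d : ℤ) : ℚ) * B (v i) (v j) := by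
        have h2 : f ((Pᵀ * S * P) i j) = ((P.map f)ᵀ * S.map f * P.map f) i j := by
          rw [← transpose_map, ← Matrix.map_mul, ← Matrix.map_mul]; rfl
        rw [h2, hP]
        rw [transpose_smul, Matrix.smul_mul, Matrix.smul_mul, Matrix.mul_smul, smul_smul, Matrix.smul_apply,
          smul_eq_mul, Matrix.toBilin'_apply', Matrix.mul_assoc]
        rfl
      rw [hv i j hij, mul_zero] at h1
      exact Int.cast_injective (α := ℚ) (by simpa [f] using h1)
  have ha : ∀ i, a i ≠ 0 := by
    have h := congrArg det hdiag
    rw [det_mul, det_mul, det_transpose, det_diagonal] at h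
    have h2 : ∏ i, a i ≠ 0 := by rw [← h]; exact mul_ne_zero (mul_ne_zero hdetP hdet) hdetP
    exact fun i => (Finset.prod_ne_zero_iff.mp h2) i (Finset.mem_univ i)
  let M : ℕ := ∏ i, (a i).natAbs
  have hM : 0 < M := Finset.prod_pos fun i _ => Int.natAbs_pos.mpr (ha i)
  have hdvd : ∀ i, a i ∣ (M : ℤ) := fun i =>
    Int.natAbs_dvd.mp (Int.natCast_dvd_natCast.mpr (Finset.dvd_prod_of_mem _ (Finset.mem_univ i)))
  have hk : ∀ i, (M : ℤ) / a i * a i = M := fun i => Int.ediv_mul_cancel (hdvd i)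
  refine ⟨P, a, fun i => (M : ℤ) / a i, M, hM, hk, hdiag, ?_⟩
  refine mul_eq_smul_one_comm (by exact_mod_cast hM.ne') ?_
  rw [mul_assoc, hdiag, diagonal_mul_diagonal]
  simp only [hk]
  rw [← smul_one_eq_diagonal]

/-- A unimodular symmetric matrix is diagonalised by an integral matrix that is invertible over
`ℚ`, and the Gauss sum of the form mod `2` has the phase given by its signature. -/
theorem exists_diagonalization_gaussSum {n : ℕ} (S S' : Matrix (Fin n) (Fin n) ℤ) (hS : S.IsSymm)
    (hSS' : S * S' = 1) :
    ∃ (P Q : Matrix (Fin n) (Fin n) ℤ) (a : Fin n → ℤ) (M : ℤ), M ≠ 0 ∧ (∀ i, a i ≠ 0) ∧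
      Pᵀ * S * P = diagonal a ∧ P * Q = M • 1 ∧
      ∃ c : ℝ, 0 < c ∧ ∑ l : Fin n → ZMod 4,
        ZMod.stdAddChar (l ⬝ᵥ (S.map (Int.cast : ℤ → ZMod 4)) *ᵥ l) =
          c * Complex.exp (Real.pi * Complex.I / 4 * (∑ i, (a i).sign : ℤ)) := by
  have hdet : S.det ≠ 0 := by
    have := congrArg det hSS'
    rw [det_mul, det_one] at this
    exact left_ne_zero_of_mul (this ▸ one_ne_zero)
  obtain ⟨P, a, k, M, hM, hk, hP, hPQ⟩ := exists_int_diagonalization S hS hdet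
  refine ⟨P, _, a, M, by exact_mod_cast hM.ne', fun i h => ?_, hP, hPQ, ?_⟩
  · have := hk i
    rw [h, mul_zero] at this
    exact hM.ne (by exact_mod_cast this)
  -- With `R = PᵀS` one gets `RᵀKR = S (P K PᵀS) = M S`.
  · refine exists_pos_sum_stdAddChar_unimodular S S' (Pᵀ * S) a k M hM hk hSS' ?_
    rw [transpose_mul, transpose_transpose, hS.eq, mul_assoc S, mul_assoc S, mul_assoc P, hPQ,
      mul_smul_comm, mul_one]

end Diagonalization

/-! ### Slant products and the extension of homomorphisms between free abelian groups. -/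

theorem tensorEval_intCast_left {M N R : Type*} [AddCommGroup M] [AddCommGroup N] [CommRing R]
    (u : M →ₗ[ℤ] ℤ) (v : N →ₗ[ℤ] R) (x : M ⊗[ℤ] N) :
    tensorEval ((Int.castAddHom R).toIntLinearMap ∘ₗ u) v x = v (tensorSlant x u) := by
  induction x using TensorProduct.induction_on with
  | zero => simp [tensorSlant]
  | tmul a b => simp [tensorSlant]
  | add a b ha hb => rw [map_add, ha, hb, ← map_add]; simp [tensorSlant]

/-- The projection to the kernel of a homomorphism to a free abelian group of finite rank. -/
theorem exists_projection_ker {M N : Type*} [AddCommGroup M] [AddCommGroup N] [Module.Free ℤ N]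
    [Module.Finite ℤ N] (f : M →ₗ[ℤ] N) :
    ∃ π : M →ₗ[ℤ] M, (∀ c, f (π c) = 0) ∧ ∀ c, f c = 0 → π c = c := by
  obtain ⟨s, hs⟩ := Module.projective_lifting_property f.rangeRestrict LinearMap.id
    f.surjective_rangeRestrict
  refine ⟨LinearMap.id - s ∘ₗ f.rangeRestrict, fun c => ?_, fun c hc => ?_⟩
  · have h := congrArg Subtype.val (LinearMap.congr_fun hs (f.rangeRestrict c))
    have h' : f (s (f.rangeRestrict c)) = f c := h
    simp [h']
  · have : f.rangeRestrict c = 0 := Subtype.ext hc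
    simp [this]

/-- `M / ker f` embeds in `N`, and the injectivity of `Q` extends the induced map. -/
theorem exists_comp_eq_of_ker_le {M N Q : Type*} [AddCommGroup M] [AddCommGroup N] [AddCommGroup Q]
    (hQ : Module.Baer ℤ Q) (f : M →ₗ[ℤ] N) (x : M →ₗ[ℤ] Q) (hx : ∀ c, f c = 0 → x c = 0) :
    ∃ w : N →ₗ[ℤ] Q, w ∘ₗ f = x := by
  obtain ⟨w, hw⟩ := hQ.extension_property ((LinearMap.ker f).liftQ f le_rfl)
    (LinearMap.ker_eq_bot.mp (Submodule.ker_liftQ_eq_bot _ _ _ le_rfl))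
    ((LinearMap.ker f).liftQ x fun c hc => hx c hc)
  exact ⟨w, LinearMap.ext fun c => LinearMap.congr_fun hw (Submodule.Quotient.mk c)⟩

/-- A homomorphism `M → ℤ/2` that vanishes wherever `f` is even factors through `f`. -/
theorem exists_comp_eq_of_even {M N : Type*} [AddCommGroup M] [AddCommGroup N]
    [Module.Free ℤ M] [Module.Finite ℤ M] [Module.Free ℤ N] (f : M →ₗ[ℤ] N)
    (x : M →ₗ[ℤ] ZMod 2) (hx : ∀ c e, f c = 2 • e → x c = 0) :
    ∃ w : N →ₗ[ℤ] ZMod 2, w ∘ₗ f = x := by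
  classical
  let δ : (N →ₗ[ℤ] ZMod 2) →ₗ[ZMod 2] (M →ₗ[ℤ] ZMod 2) :=
    { toFun := fun w => w ∘ₗ f
      map_add' := fun _ _ => LinearMap.add_comp _ _ _
      map_smul' := fun _ _ => LinearMap.smul_comp _ _ _ }
  by_contra hcon
  have hmem : x ∉ LinearMap.range δ := fun ⟨w, hw⟩ => hcon ⟨w, hw⟩
  -- A functional separating `x` from the factorable maps is evaluation at some `c` of `M`, as `M`
  -- is free of finite rank. Killing every `w ∘ₗ f` makes all coordinates of `f c` even, so the
  -- hypothesis forces `x c = 0`.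
  obtain ⟨ℓ, hℓx, hℓ⟩ := Submodule.exists_dual_map_eq_bot_of_notMem hmem inferInstance
  have hℓ' : ∀ w, ℓ (δ w) = 0 := fun w => by
    have : ℓ (δ w) ∈ (LinearMap.range δ).map ℓ := ⟨_, ⟨w, rfl⟩, rfl⟩
    rwa [hℓ] at this
  let b := Module.Free.chooseBasis ℤ M
  let c : M := ∑ i, (ℓ ((Int.castAddHom (ZMod 2)).toIntLinearMap ∘ₗ b.coord i)).val • b i
  have hc : ∀ y : M →ₗ[ℤ] ZMod 2, ℓ y = y c := by
    intro y
    have hy : y = ∑ i, y (b i) • ((Int.castAddHom (ZMod 2)).toIntLinearMap ∘ₗ b.coord i) := by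
      refine b.ext fun j => ?_
      simp [LinearMap.sum_apply, Finsupp.single_apply]
    conv_lhs => rw [hy]
    rw [map_sum, map_sum]
    refine Finset.sum_congr rfl fun i _ => ?_
    rw [map_smul, map_nsmul, nsmul_eq_mul, ZMod.natCast_zmod_val, smul_eq_mul, mul_comm]
  have hfc : ∃ e, f c = 2 • e := by
    let b' := Module.Free.chooseBasis ℤ N
    have h0 : ∀ j, (2 : ℤ) ∣ b'.repr (f c) j := fun j => by
      have := hℓ' ((Int.castAddHom (ZMod 2)).toIntLinearMap ∘ₗ b'.coord j)
      rw [hc] at this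
      exact (ZMod.intCast_zmod_eq_zero_iff_dvd _ 2).mp this
    choose e he using h0
    refine ⟨b'.repr.symm ((b'.repr (f c)).mapRange (fun z => z / 2) (by simp)), b'.repr.injective ?_⟩
    ext j
    rw [map_nsmul, LinearEquiv.apply_symm_apply, Finsupp.smul_apply, Finsupp.mapRange_apply,
      he j]
    simp
  obtain ⟨e, he⟩ := hfc
  exact hℓx (by rw [hc]; exact hx c e he)

namespace SymmetricComplex

/-! ### Poincaré duality at the level of cochains. -/

section Duality

variable {n : ℤ} (X : SymmetricComplex.{u} n)

/-- A chain homotopy inverse of the duality map, in two adjacent degrees. -/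
theorem IsPoincare.exists_inverse {X : SymmetricComplex.{u} n} (hX : X.IsPoincare) {p p' r r' : ℤ}
    (hp : n - r = p) (hp' : n - r' = p') (hr : r = r' + 1) :
    ∃ (g : X.C.X r →ₗ[ℤ] X.C.X p →ₗ[ℤ] ℤ) (g' : X.C.X r' →ₗ[ℤ] X.C.X p' →ₗ[ℤ] ℤ)
      (h : X.C.X r →ₗ[ℤ] X.C.X (r + 1)) (h' : X.C.X r' →ₗ[ℤ] X.C.X r),
      (∀ c, tensorSlant (X.φ 0 p r) (g c) = c + chainD X.C (r + 1) r (h c) + h' (chainD X.C r r' c)) ∧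
      ∀ c, X.coboundary ℤ p p' (g c) = g' (chainD X.C r r' c) := by
  subst hp hp'
  obtain ⟨⟨f, i, hfi, e⟩, he⟩ := hX
  dsimp only at he
  subst he
  have hcomm := e.comm r
  rw [dNext_eq _ (show (ComplexShape.down ℤ).Rel r r' by simp [hr]),
    prevD_eq _ (show (ComplexShape.down ℤ).Rel (r + 1) r by simp)] at hcomm
  refine ⟨(i.f r).hom.toIntLinearMap,
    -- The sign `(-1)^r` of the dual differential is absorbed into `g'`.
    ((r.negOnePow : ℤ) • (i.f r').hom).toIntLinearMap,
    (e.hom r (r + 1)).hom.toIntLinearMap,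
    (e.hom r' r).hom.toIntLinearMap, fun c => ?_, fun c => ?_⟩
  · have h := ConcreteCategory.congr_hom hcomm c
    have h' : tensorSlant (X.φ 0 (n - r) r) ((i.f r).hom c) =
        (e.hom r' r).hom ((X.C.d r r').hom c) +
          (X.C.d (r + 1) r).hom ((e.hom r (r + 1)).hom c) + c := h
    change tensorSlant (X.φ 0 (n - r) r) ((i.f r).hom c) = _
    rw [h']
    simp only [chainD, AddMonoidHom.coe_toIntLinearMap]
    abel
  · have h := ConcreteCategory.congr_hom (i.comm r r') c
    have h' : (r.negOnePow : ℤ) • (X.coboundary ℤ (n - r) (n - r') ((i.f r).hom c)) =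
        (i.f r').hom ((X.C.d r r').hom c) := h
    change X.coboundary ℤ (n - r) (n - r') ((i.f r).hom c) =
      (r.negOnePow : ℤ) • ((i.f r').hom ((X.C.d r r').hom c))
    have aux : ∀ y : X.C.X (n - r') →ₗ[ℤ] ℤ, y = (r.negOnePow : ℤ) • (r.negOnePow : ℤ) • y :=
      fun y => by rw [smul_smul, Int.units_coe_mul_self, one_smul]
    rw [← h']
    exact aux _

variable (R : Type) [CommRing R]

/-- An integral cochain as a cochain with values in `R`. -/
def castCochain {p : ℤ} : (X.C.X p →ₗ[ℤ] ℤ) →ₗ[ℤ] (X.C.X p →ₗ[ℤ] R) where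
  toFun u := (Int.castAddHom R).toIntLinearMap ∘ₗ u
  map_add' _ _ := LinearMap.comp_add _ _ _
  map_smul' _ _ := LinearMap.comp_smul _ _ _

variable {R}

theorem castCochain_apply {p : ℤ} (u : X.C.X p →ₗ[ℤ] ℤ) (c : X.C.X p) :
    X.castCochain R u c = (u c : R) := rfl

theorem coboundary_castCochain {p q : ℤ} (u : X.C.X p →ₗ[ℤ] ℤ) :
    X.coboundary R p q (X.castCochain R u) = X.castCochain R (X.coboundary ℤ p q u) := rfl

theorem castCochain_mem_cocycles {p : ℤ} {u : X.C.X p →ₗ[ℤ] ℤ} (hu : u ∈ X.cocycles ℤ p) :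
    X.castCochain R u ∈ X.cocycles R p := by
  rw [cocycles, LinearMap.mem_ker, coboundary_castCochain, LinearMap.mem_ker.mp hu, map_zero]

theorem pairing_castCochain {p q : ℤ} (u : X.C.X p →ₗ[ℤ] ℤ) (v : X.C.X q →ₗ[ℤ] R) :
    X.cochainPairing 0 p q (X.castCochain R u) v = v (tensorSlant (X.φ 0 p q) u) :=
  tensorEval_intCast_left u v _

theorem pairing_castCochain_castCochain {p q : ℤ} (u : X.C.X p →ₗ[ℤ] ℤ) (v : X.C.X q →ₗ[ℤ] ℤ) :
    X.cochainPairing 0 p q (X.castCochain R u) (X.castCochain R v) =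
      (X.cochainPairing 0 p q u v : R) := by
  rw [pairing_castCochain, castCochain_apply]
  congr 1
  exact (X.pairing_castCochain (R := ℤ) u v).symm

theorem pairing_int_eq {p q : ℤ} (u : X.C.X p →ₗ[ℤ] ℤ) (v : X.C.X q →ₗ[ℤ] ℤ) :
    X.cochainPairing 0 p q u v = v (tensorSlant (X.φ 0 p q) u) :=
  X.pairing_castCochain (R := ℤ) u v

theorem cocycle_apply_boundary {p p' : ℤ} (hp : p' = p + 1) {x : X.C.X p →ₗ[ℤ] R}
    (hx : x ∈ X.cocycles R p) (c : X.C.X p') : x (chainD X.C p' p c) = 0 := by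
  subst hp
  exact LinearMap.congr_fun (LinearMap.mem_ker.mp hx) c

theorem chainD_tensorSlant {p q q' : ℤ} (hq : q' = q + 1) {z : X.C.X p →ₗ[ℤ] ℤ}
    (hz : z ∈ X.cocycles ℤ p) : chainD X.C q' q (tensorSlant (X.φ 0 p q') z) = 0 := by
  have h := congrArg (fun t => tensorSlant t z) (X.cycle_zero' (p := p) (p' := p + 1) rfl hq)
  have hz' : z ∘ₗ chainD X.C (p + 1) p = 0 := LinearMap.mem_ker.mp hz
  have h1 : ∀ a b : X.C.X p ⊗[ℤ] X.C.X q,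
      tensorSlant (a + b) z = tensorSlant a z + tensorSlant b z := fun a b => by simp [tensorSlant]
  have h2 : ∀ (m : ℤ) (a : X.C.X p ⊗[ℤ] X.C.X q),
      tensorSlant (m • a) z = m • tensorSlant a z := fun m a => by simp [tensorSlant]
  have h3 : tensorSlant (0 : X.C.X p ⊗[ℤ] X.C.X q) z = 0 := by simp [tensorSlant]
  simpa only [h1, h2, h3, tensorSlant_lTensor, tensorSlant_rTensor, hz', map_zero, smul_zero,
    add_zero] using h

/-- A cocycle orthogonal to the integral cocycles vanishes on the integral cycles. -/
theorem IsPoincare.apply_cycle_eq_zero {X : SymmetricComplex.{u} n} (hX : X.IsPoincare)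
    {p r : ℤ} (hp : n - r = p) {x : X.C.X r →ₗ[ℤ] R} (hx : x ∈ X.cocycles R r)
    (h : ∀ z ∈ X.cocycles ℤ p, x (tensorSlant (X.φ 0 p r) z) = 0) {c : X.C.X r}
    (hc : chainD X.C r (r - 1) c = 0) : x c = 0 := by
  obtain ⟨g, g', h₀, h₁, h2, h3⟩ := hX.exists_inverse hp (p' := p + 1) (r' := r - 1)
    (by omega) (by omega)
  -- The cycle `c` is homologous to the dual of the integral cocycle `g c`, and `x` does not see
  -- boundaries.
  have h4 := h (g c) (LinearMap.mem_ker.mpr (by rw [h3, hc, map_zero]))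
  rw [h2, hc, map_zero, add_zero, map_add, X.cocycle_apply_boundary rfl hx, add_zero] at h4
  exact h4

/-- The pairing of cohomology with coefficients `ℤ/2` in complementary degrees is nonsingular. -/
theorem IsPoincare.mem_coboundaries_of_pairing_eq_zero {X : SymmetricComplex.{u} n}
    (hX : X.IsPoincare) {p r : ℤ} (hp : n - r = p) {x : X.C.X r →ₗ[ℤ] ZMod 2}
    (hx : x ∈ X.cocycles (ZMod 2) r)
    (h : ∀ z ∈ X.cocycles (ZMod 2) p, X.cochainPairing 0 p r z x = 0) :
    x ∈ X.coboundaries (ZMod 2) r := by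
  obtain ⟨g, g', h₀, h₁, h2, h3⟩ := hX.exists_inverse hp (p' := p + 1) (r' := r - 1)
    (by omega) (by omega)
  have := X.free r
  have := X.finite r
  have := X.free (r - 1)
  have h20 : ∀ {q : ℤ} (y : X.C.X q →ₗ[ℤ] ZMod 2) (e : X.C.X q), y (2 • e) = 0 := fun y e => by
    rw [map_nsmul, nsmul_eq_mul]
    exact mul_eq_zero_of_left (by decide) _
  -- It suffices to test `x` on cycles modulo `2`, the `c` with `d c = 2e`; for these `g c` is a
  -- cocycle modulo `2`, and the error terms in the homotopy are boundaries or even.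
  refine exists_comp_eq_of_even (chainD X.C r (r - 1)) x fun c e hc => ?_
  have hg : X.castCochain (ZMod 2) (g c) ∈ X.cocycles (ZMod 2) p := by
    rw [cocycles, LinearMap.mem_ker, coboundary_castCochain, h3, hc]
    ext y
    rw [castCochain_apply, map_nsmul, LinearMap.smul_apply, nsmul_eq_mul]
    push_cast
    exact mul_eq_zero_of_left (by decide) _
  have h4 := h _ hg
  rw [pairing_castCochain, h2, hc, map_add, map_add, X.cocycle_apply_boundary rfl hx, add_zero,
    map_nsmul, h20, add_zero] at h4
  exact h4

theorem mem_coboundaries_real_of_apply_cycle {r : ℤ} {x : X.C.X r →ₗ[ℤ] ℝ}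
    (h : ∀ c, chainD X.C r (r - 1) c = 0 → x c = 0) : x ∈ X.coboundaries ℝ r :=
  exists_comp_eq_of_ker_le (Module.Baer.of_divisible ℝ) (chainD X.C r (r - 1)) x h

end Duality

end SymmetricComplex

namespace SymmetricComplex

/-! ### The integral lattice in the middle dimension and the signature. -/

section MiddleDimension

variable {k : ℤ} (X : SymmetricComplex.{u} (4 * k))

/-- `φ_1` is a chain homotopy between `φ_0` and its transpose, and its contribution vanishes on
cocycles. -/
theorem pairing_middle_comm {R : Type} [CommRing R] {u v : X.C.X (2 * k) →ₗ[ℤ] R}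
    (hu : u ∈ X.cocycles R (2 * k)) (hv : v ∈ X.cocycles R (2 * k)) :
    X.cochainPairing 0 (2 * k) (2 * k) u v = X.cochainPairing 0 (2 * k) (2 * k) v u := by
  have h := X.pairing_succ_relation 0 (p := 2 * k) (q := 2 * k) rfl rfl u v
  rw [LinearMap.mem_ker.mp hu, LinearMap.mem_ker.mp hv, map_zero, map_zero] at h
  have e3 : (4 * k).negOnePow = 1 := Int.negOnePow_even _ ⟨2 * k, by ring⟩
  have e4 : (2 * k * (2 * k)).negOnePow = 1 :=
    Int.negOnePow_even _ ((even_two_mul k).mul_left _)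
  simp only [e3, e4, LinearMap.zero_apply, Nat.cast_zero, zero_add, add_zero, smul_zero,
    Int.negOnePow_one, Units.val_one, Units.val_neg, one_smul, neg_smul] at h
  exact sub_eq_zero.mp (by rw [sub_eq_add_neg]; exact h)

/-- The integral cochain `y` vanishes on the integral cycles. -/
def VanishesOnCycles (y : X.C.X (2 * k) →ₗ[ℤ] ℤ) : Prop :=
  ∀ c, chainD X.C (2 * k) (2 * k - 1) c = 0 → y c = 0

theorem chainD_chainD (p q r : ℤ) (c : X.C.X p) : chainD X.C q r (chainD X.C p q c) = 0 := by
  have : (X.C.d q r) ((X.C.d p q) c) = 0 := by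
    rw [← ConcreteCategory.comp_apply, X.C.d_comp_d]; rfl
  exact this

theorem VanishesOnCycles.mem_cocycles {X : SymmetricComplex.{u} (4 * k)}
    {y : X.C.X (2 * k) →ₗ[ℤ] ℤ} (hy : X.VanishesOnCycles y) : y ∈ X.cocycles ℤ (2 * k) :=
  LinearMap.mem_ker.mpr (LinearMap.ext fun c => hy _ (X.chainD_chainD _ _ _ c))

theorem VanishesOnCycles.pairing_eq_zero {X : SymmetricComplex.{u} (4 * k)}
    {y z : X.C.X (2 * k) →ₗ[ℤ] ℤ} (hy : X.VanishesOnCycles y) (hz : z ∈ X.cocycles ℤ (2 * k)) :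
    X.cochainPairing 0 (2 * k) (2 * k) z y = 0 := by
  rw [pairing_int_eq]
  exact hy _ (X.chainD_tensorSlant (by omega) hz)

/-- Together with `VanishesOnCycles.pairing_eq_zero` this identifies the radical of the form on
integral cocycles: it consists of the cocycles of torsion classes. -/
theorem IsPoincare.vanishesOnCycles {X : SymmetricComplex.{u} (4 * k)} (hX : X.IsPoincare)
    {y : X.C.X (2 * k) →ₗ[ℤ] ℤ} (hy : y ∈ X.cocycles ℤ (2 * k))
    (h : ∀ z ∈ X.cocycles ℤ (2 * k), z (tensorSlant (X.φ 0 (2 * k) (2 * k)) y) = 0) :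
    X.VanishesOnCycles y := fun c hc => by
  refine hX.apply_cycle_eq_zero (p := 2 * k) (by ring) hy (fun z hz => ?_) hc
  rw [← pairing_int_eq, X.pairing_middle_comm hz hy, pairing_int_eq]
  exact h z hz

/-- The form on the integral middle cocycles is unimodular modulo its radical. -/
theorem IsPoincare.exists_pairing_eq {X : SymmetricComplex.{u} (4 * k)} (hX : X.IsPoincare)
    (f : X.cocycles ℤ (2 * k) →ₗ[ℤ] ℤ) (hf : ∀ y, X.VanishesOnCycles y.1 → f y = 0) :
    ∃ x ∈ X.cocycles ℤ (2 * k), ∀ z : X.cocycles ℤ (2 * k),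
      X.cochainPairing 0 (2 * k) (2 * k) z.1 x = f z := by
  obtain ⟨g, g', h₀, h₁, h2, h3⟩ := hX.exists_inverse (p := 2 * k) (r := 2 * k) (p' := 2 * k + 1)
    (r' := 2 * k - 1) (by ring) (by ring) (by ring)
  have := X.free (2 * k - 1)
  have := X.finite (2 * k - 1)
  obtain ⟨π, hπ, hπ'⟩ := exists_projection_ker (chainD X.C (2 * k) (2 * k - 1))
  have hg : ∀ c, chainD X.C (2 * k) (2 * k - 1) c = 0 → g c ∈ X.cocycles ℤ (2 * k) := fun c hc =>
    LinearMap.mem_ker.mpr (by rw [h3, hc, map_zero])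
  -- `g` takes cocycle values only on cycles, so it is precomposed with a projection onto them; `f`
  -- can then be applied to every value.
  let G : X.C.X (2 * k) →ₗ[ℤ] X.cocycles ℤ (2 * k) :=
    LinearMap.codRestrict _ (g ∘ₗ π) fun c => hg _ (hπ c)
  have hG : ∀ c, chainD X.C (2 * k) (2 * k - 1) c = 0 → (G c).1 = g c := fun c hc =>
    congrArg g (hπ' c hc)
  -- Both claims follow because `f` kills the radical: `G` of a boundary lies in it, and so does `G
  -- (φ_0 z) - z`.
  refine ⟨f ∘ₗ G, LinearMap.mem_ker.mpr (LinearMap.ext fun c => ?_), fun z => ?_⟩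
  · refine hf _ (hX.vanishesOnCycles (G _).2 fun z hz => ?_)
    have hc := X.chainD_chainD (2 * k + 1) (2 * k) (2 * k - 1) c
    rw [hG _ hc, h2, hc, map_zero, add_zero, map_add, X.cocycle_apply_boundary rfl hz,
      X.cocycle_apply_boundary rfl hz, add_zero]
  · rw [pairing_int_eq]
    have hc := X.chainD_tensorSlant (q := 2 * k - 1) (q' := 2 * k) (by omega) z.2
    have h0 : f (G (tensorSlant (X.φ 0 (2 * k) (2 * k)) z.1) - z) = 0 := by
      refine hf _ (hX.vanishesOnCycles (Subtype.prop _) fun z' hz' => ?_)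
      rw [Submodule.coe_sub, hG _ hc, map_sub, h2, hc, map_zero, add_zero, add_sub_cancel_left,
        X.cocycle_apply_boundary rfl hz']
    rw [map_sub, sub_eq_zero] at h0
    exact h0

/-- A basis of the integral middle cocycles modulo those vanishing on cycles, with its
coordinate functions. -/
theorem exists_cocycle_basis :
    ∃ (m : ℕ) (z : Fin m → X.cocycles ℤ (2 * k)) (coord : Fin m → X.cocycles ℤ (2 * k) →ₗ[ℤ] ℤ),
      (∀ i y, X.VanishesOnCycles y.1 → coord i y = 0) ∧
      (∀ i j, coord i (z j) = if j = i then 1 else 0) ∧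
      ∀ y, X.VanishesOnCycles (y - ∑ i, coord i y • z i).1 := by
  have := X.free (2 * k)
  have := X.finite (2 * k)
  let K := LinearMap.ker (chainD X.C (2 * k) (2 * k - 1))
  -- Restriction to cycles has the radical as kernel, and its image is free as a subgroup of a free
  -- group of finite rank.
  let ρ : X.cocycles ℤ (2 * k) →ₗ[ℤ] (K →ₗ[ℤ] ℤ) :=
    (LinearMap.lcomp ℤ ℤ K.subtype) ∘ₗ (X.cocycles ℤ (2 * k)).subtype
  have hρ : ∀ y, ρ y = 0 ↔ X.VanishesOnCycles y.1 := fun y =>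
    ⟨fun h c hc => LinearMap.congr_fun h ⟨c, hc⟩, fun h => LinearMap.ext fun c => h c.1 c.2⟩
  let b := Module.finBasis ℤ (LinearMap.range ρ)
  choose z hz using fun i => ρ.surjective_rangeRestrict (b i)
  refine ⟨_, z, fun i => b.coord i ∘ₗ ρ.rangeRestrict, fun i y hy => ?_, fun i j => ?_, fun y => ?_⟩
  · have : ρ.rangeRestrict y = 0 := Subtype.ext ((hρ y).mpr hy)
    simp [this]
  · simp [hz, Finsupp.single_apply]
  · rw [← hρ]
    have h : ρ.rangeRestrict (y - ∑ i, (b.coord i ∘ₗ ρ.rangeRestrict) y • z i) = 0 := by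
      rw [map_sub, map_sum]
      simp only [map_smul, hz, LinearMap.comp_apply, Module.Basis.coord_apply]
      rw [b.sum_repr, sub_self]
    exact congrArg Subtype.val h

theorem cupForm_real_isSymm : (X.cupForm ℝ (2 * k) (2 * k)).IsSymm := by
  refine ⟨fun x y => ?_⟩
  obtain ⟨x, rfl⟩ := Submodule.Quotient.mk_surjective _ x
  obtain ⟨y, rfl⟩ := Submodule.Quotient.mk_surjective _ y
  exact X.pairing_middle_comm x.2 y.2

theorem signature_eq_sum_sign {m : ℕ} (v : Module.Basis (Fin m) ℝ (X.Cohomology ℝ (2 * k)))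
    (a : Fin m → ℤ)
    (hv : ∀ i j, X.cupForm ℝ (2 * k) (2 * k) (v i) (v j) = if i = j then (a i : ℝ) else 0) :
    X.signature = ∑ i, (a i).sign := by
  classical
  let B := X.cupForm ℝ (2 * k) (2 * k)
  let Q : QuadraticForm ℝ (X.Cohomology ℝ (2 * k)) := LinearMap.BilinMap.toQuadraticMap B
  have hass : QuadraticMap.associated (R := ℝ) Q = B := by
    exact QuadraticMap.associated_left_inverse ℝ fun x y => X.cupForm_real_isSymm.eq x y
  have hortho : LinearMap.IsOrthoᵢ (QuadraticMap.associated (R := ℝ) Q) v := by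
    rw [hass]
    intro i j hij
    change X.cupForm ℝ (2 * k) (2 * k) (v i) (v j) = 0
    rw [hv, if_neg hij]
  have hequiv : QuadraticMap.Equivalent Q
      (QuadraticMap.weightedSumSquares ℝ fun i => (a i : ℝ)) := by
    have h := QuadraticMap.isometryEquivBasisRepr Q v
    rw [QuadraticMap.basisRepr_eq_of_iIsOrtho Q v hortho] at h
    have : (fun i => Q (v i)) = fun i => (a i : ℝ) := funext fun i => by
      have := hv i i
      rw [if_pos rfl] at this
      exact this
    rw [this] at h
    exact ⟨h⟩
  have h1 : X.signature = (sigPos Q : ℤ) - (sigNeg Q : ℤ) := rfl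
  rw [h1, QuadraticForm.sigPos_of_equiv_weightedSumSquares hequiv,
    QuadraticForm.sigNeg_of_equiv_weightedSumSquares hequiv]
  have h2 : ∀ p : Fin m → Prop, ({i | p i}.ncard : ℤ) = ∑ i, if p i then 1 else 0 := fun p => by
    rw [Set.ncard_eq_toFinset_card', Finset.sum_boole]; simp
  rw [h2, h2, ← Finset.sum_sub_distrib]
  refine Finset.sum_congr rfl fun i _ => ?_
  rcases lt_trichotomy (a i) 0 with h | h | h
  · simp [Int.sign_eq_neg_one_of_neg h, h, h.not_gt]
  · simp [h]
  · simp [Int.sign_eq_one_of_pos h, h, h.not_gt]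

/-- Over `ℝ` a cochain vanishing on cycles is a coboundary, `ℝ` being divisible. -/
theorem VanishesOnCycles.pairing_real_eq_zero {X : SymmetricComplex.{u} (4 * k)}
    {t : X.C.X (2 * k) →ₗ[ℤ] ℤ} (ht : X.VanishesOnCycles t) {y : X.C.X (2 * k) →ₗ[ℤ] ℝ}
    (hy : y ∈ X.cocycles ℝ (2 * k)) :
    X.cochainPairing 0 (2 * k) (2 * k) (X.castCochain ℝ t) y = 0 := by
  refine X.pairing_coboundary_left _ _ (X.mem_coboundaries_real_of_apply_cycle fun c hc => ?_) hy
  rw [castCochain_apply, ht c hc, Int.cast_zero]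

/-- Integral cocycles that are orthogonal with nonzero squares, and rationally span, give a basis
of the real cohomology. -/
theorem IsPoincare.exists_real_basis {X : SymmetricComplex.{u} (4 * k)} (hX : X.IsPoincare)
    {m : ℕ} (e : Fin m → X.cocycles ℤ (2 * k)) (a : Fin m → ℤ) (ha : ∀ i, a i ≠ 0)
    (he : ∀ i j, X.cochainPairing 0 (2 * k) (2 * k) (e i).1 (e j).1 = if i = j then a i else 0)
    (hspan : ∀ y : X.cocycles ℤ (2 * k), ∃ (M : ℤ) (c : Fin m → ℤ), M ≠ 0 ∧
      X.VanishesOnCycles (M • y - ∑ i, c i • e i).1) :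
    ∃ v : Module.Basis (Fin m) ℝ (X.Cohomology ℝ (2 * k)), ∀ i j,
      X.cupForm ℝ (2 * k) (2 * k) (v i) (v j) = if i = j then (a i : ℝ) else 0 := by
  let E : Fin m → X.cocycles ℝ (2 * k) := fun i =>
    ⟨X.castCochain ℝ (e i).1, X.castCochain_mem_cocycles (e i).2⟩
  let V : Fin m → X.Cohomology ℝ (2 * k) := fun i => Submodule.Quotient.mk (E i)
  have hE : ∀ i j, X.cochainPairing 0 (2 * k) (2 * k) (E i).1 (E j).1 =
      if i = j then (a i : ℝ) else 0 := fun i j => by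
    have := X.pairing_castCochain_castCochain (R := ℝ) (e i).1 (e j).1
    rw [he] at this
    refine this.trans ?_
    split_ifs <;> simp
  have hV : ∀ i j, X.cupForm ℝ (2 * k) (2 * k) (V i) (V j) = if i = j then (a i : ℝ) else 0 := hE
  have hli : LinearIndependent ℝ V := by
    refine LinearMap.linearIndependent_of_isOrthoᵢ (B := X.cupForm ℝ (2 * k) (2 * k))
      (fun i j hij => ?_) fun i h => ?_
    · change X.cupForm ℝ (2 * k) (2 * k) (V i) (V j) = 0
      rw [hV, if_neg hij]
    · have h' : X.cupForm ℝ (2 * k) (2 * k) (V i) (V i) = 0 := h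
      rw [hV, if_pos rfl] at h'
      exact ha i (by exact_mod_cast h')
  refine ⟨Module.Basis.mk hli fun x _ => ?_, fun i j => by simpa using hV i j⟩
  obtain ⟨y, rfl⟩ := Submodule.Quotient.mk_surjective _ x
  let b : X.cocycles ℝ (2 * k) →ₗ[ℝ] X.cocycles ℝ (2 * k) →ₗ[ℝ] ℝ :=
    (X.cochainPairing 0 (2 * k) (2 * k)).domRestrict₁₂ _ _
  -- The Gram–Schmidt remainder is orthogonal to all `E i`, hence by the rational spanning
  -- hypothesis to every integral cocycle, hence a coboundary by duality.
  let y' : X.cocycles ℝ (2 * k) := y - ∑ i, (b (E i) y / a i) • E i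
  have h1 : ∀ j, b (E j) y' = 0 := fun j => by
    have hb : ∀ i, b (E j) (E i) = if j = i then (a j : ℝ) else 0 := fun i => hE j i
    have haj : (a j : ℝ) ≠ 0 := by exact_mod_cast ha j
    simp only [y', map_sub, map_sum, map_smul, hb, smul_eq_mul, mul_ite, mul_zero,
      Finset.sum_ite_eq, Finset.mem_univ, if_true]
    field_simp
    ring
  have h2 : ∀ z : X.cocycles ℤ (2 * k),
      X.cochainPairing 0 (2 * k) (2 * k) (X.castCochain ℝ z.1) y'.1 = 0 := fun z => by
    obtain ⟨M, c, hM, hc⟩ := hspan z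
    have h3 := hc.pairing_real_eq_zero y'.2
    have h4 : X.castCochain ℝ (M • z - ∑ i, c i • e i).1 =
        (M : ℝ) • X.castCochain ℝ z.1 - ∑ i, (c i : ℝ) • (E i).1 := by
      ext w
      simp [castCochain_apply, E, LinearMap.sum_apply]
    rw [h4, map_sub, map_sum] at h3
    simp only [LinearMap.map_smul, LinearMap.sub_apply, LinearMap.sum_apply, LinearMap.smul_apply]
      at h3
    have h5 : ∀ i, X.cochainPairing 0 (2 * k) (2 * k) (E i).1 y'.1 = 0 := h1
    simp only [h5, smul_eq_mul, mul_zero, Finset.sum_const_zero, sub_zero] at h3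
    exact (mul_eq_zero.mp h3).resolve_left (by exact_mod_cast hM)
  have h3 : y'.1 ∈ X.coboundaries ℝ (2 * k) :=
    X.mem_coboundaries_real_of_apply_cycle fun c hc =>
      hX.apply_cycle_eq_zero (p := 2 * k) (by ring) y'.2
        (fun z hz => by rw [← pairing_castCochain]; exact h2 ⟨z, hz⟩) hc
  have h4 : (Submodule.Quotient.mk y' : X.Cohomology ℝ (2 * k)) = 0 :=
    (Submodule.Quotient.mk_eq_zero _).mpr h3
  have h5 : (Submodule.Quotient.mk y : X.Cohomology ℝ (2 * k)) =
      ∑ i, (b (E i) y / a i) • V i := by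
    have : (Submodule.Quotient.mk y' : X.Cohomology ℝ (2 * k)) =
        Submodule.Quotient.mk y - ∑ i, (b (E i) y / a i) • V i := by
      change Submodule.mkQ _ y' = Submodule.mkQ _ y - ∑ i, (b (E i) y / a i) • Submodule.mkQ _ (E i)
      simp only [y', map_sub, map_sum, map_smul]
    rw [h4] at this
    exact (sub_eq_zero.mp this.symm)
  rw [h5]
  exact Submodule.sum_mem _ fun i _ => Submodule.smul_mem _ _ (Submodule.subset_span ⟨i, rfl⟩)

open Matrix in
/-- The Gauss sum of the integral middle cohomology lattice. -/
theorem IsPoincare.exists_lattice_gaussSum {X : SymmetricComplex.{u} (4 * k)} (hX : X.IsPoincare) :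
    ∃ (m : ℕ) (z : Fin m → X.cocycles ℤ (2 * k)),
      (∀ y : X.cocycles ℤ (2 * k), ∃ n : Fin m → ℤ, X.VanishesOnCycles (y - ∑ i, n i • z i).1) ∧
      ∃ c : ℝ, 0 < c ∧ ∑ l : Fin m → ZMod 4, ZMod.stdAddChar (∑ i, l i * ∑ j,
        (X.cochainPairing 0 (2 * k) (2 * k) (z i).1 (z j).1 : ZMod 4) * l j) =
          c * Complex.exp (Real.pi * Complex.I / 4 * X.signature) := by
  obtain ⟨m, z, coord, hcoord, hcz, hz⟩ := X.exists_cocycle_basis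
  let b : X.cocycles ℤ (2 * k) →ₗ[ℤ] X.cocycles ℤ (2 * k) →ₗ[ℤ] ℤ :=
    (X.cochainPairing 0 (2 * k) (2 * k)).domRestrict₁₂ _ _
  have hb : ∀ x y, b x y = X.cochainPairing 0 (2 * k) (2 * k) x.1 y.1 := fun _ _ => rfl
  have hbsymm : ∀ x y, b x y = b y x := fun x y => X.pairing_middle_comm x.2 y.2
  have hb0 : ∀ x y, X.VanishesOnCycles y.1 → b x y = 0 := fun x y hy => hy.pairing_eq_zero x.2
  let S : Matrix (Fin m) (Fin m) ℤ := fun i j => b (z i) (z j)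
  have hexp : ∀ x y, b x y = ∑ i, coord i y * b x (z i) := fun x y => by
    have h := hb0 x _ (hz y)
    rw [map_sub, sub_eq_zero] at h
    rw [h, map_sum]
    simp
  choose x hx hxc using fun j => hX.exists_pairing_eq (coord j) (hcoord j)
  -- The columns are the coordinates of the cocycles dual to the coordinate functions, which makes
  -- `S'` the inverse of the Gram matrix.
  let S' : Matrix (Fin m) (Fin m) ℤ := fun i j => coord i ⟨x j, hx j⟩
  have hSS' : S * S' = 1 := by
    ext i j
    have h := hexp (z i) ⟨x j, hx j⟩
    rw [hb, hxc, hcz] at h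
    rw [Matrix.mul_apply, Matrix.one_apply, h]
    exact Finset.sum_congr rfl fun l _ => mul_comm _ _
  obtain ⟨P, Q, a, M, hM, ha, hP, hPQ, c, hc, hsum⟩ := exists_diagonalization_gaussSum S S'
    (Matrix.IsSymm.ext fun i j => hbsymm _ _) hSS'
  let e : Fin m → X.cocycles ℤ (2 * k) := fun i => ∑ j, P j i • z j
  have he : ∀ i j, b (e i) (e j) = if i = j then a i else 0 := fun i j => by
    have h := congrFun (congrFun hP i) j
    rw [Matrix.diagonal_apply] at h
    rw [← h]
    have hS : ∀ i j, b (z i) (z j) = S i j := fun _ _ => rfl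
    simp only [e, map_sum, map_smul, LinearMap.sum_apply, LinearMap.smul_apply, smul_eq_mul, hS,
      Matrix.mul_apply, Matrix.transpose_apply, Finset.mul_sum, Finset.sum_mul]
    exact Finset.sum_congr rfl fun l _ => Finset.sum_congr rfl fun l' _ => by ring
  obtain ⟨v, hv⟩ := hX.exists_real_basis e a ha he fun y => by
    have h0 : ∀ w : Fin m → ℤ, ∑ i, w i • e i = ∑ j, (P *ᵥ w) j • z j := fun w => by
      simp only [e, Finset.smul_sum, smul_smul, mulVec, dotProduct, Finset.sum_smul]
      rw [Finset.sum_comm]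
      exact Finset.sum_congr rfl fun j _ => Finset.sum_congr rfl fun i _ =>
        congrArg (· • z j) (mul_comm _ _)
    refine ⟨M, Q *ᵥ fun l => coord l y, hM, ?_⟩
    have h2 : M • y - ∑ i, (Q *ᵥ fun l => coord l y) i • e i =
        M • (y - ∑ l, coord l y • z l) := by
      rw [h0, mulVec_mulVec, hPQ, smul_sub, Finset.smul_sum]
      simp only [smul_mulVec, one_mulVec, Pi.smul_apply, smul_assoc]
    intro w hw
    rw [h2]
    change M • ((y - ∑ l, coord l y • z l).1 w) = 0
    rw [hz y w hw, smul_zero]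
  rw [← X.signature_eq_sum_sign v a hv] at hsum
  exact ⟨m, z, fun y => ⟨fun i => coord i y, hz y⟩, c, hc, hsum⟩

end MiddleDimension

end SymmetricComplex

theorem stdAddChar_four_two_mul (z : ZMod 2) :
    ZMod.stdAddChar (2 * (z.val : ZMod 4)) = ZMod.stdAddChar z := by
  have h1 : (2 * (z.val : ZMod 4)) = ((2 * z.val : ℤ) : ZMod 4) := by push_cast; rfl
  have h2 : z = ((z.val : ℤ) : ZMod 2) := by simp
  conv_rhs => rw [h2]
  rw [h1, ZMod.stdAddChar_coe, ZMod.stdAddChar_coe]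
  congr 1
  push_cast
  ring

namespace SymmetricComplex

/-! ### The Gauss sum of the Pontryagin square. -/

section PontryaginSquare

variable {k : ℤ} (X : SymmetricComplex.{u} (4 * k))

instance finite_cohomology_zmod_two (p : ℤ) : Finite (X.Cohomology (ZMod 2) p) := by
  have := X.free p
  have := X.finite p
  let b := Module.Free.chooseBasis ℤ (X.C.X p)
  have h1 : Finite (X.C.X p →ₗ[ℤ] ZMod 2) :=
    Finite.of_injective (fun f i => f (b i)) fun f g h => b.ext fun i => congrFun h i
  exact Finite.of_surjective _ (Submodule.mkQ_surjective _)

theorem middleForm_isSymm : X.middleForm.IsSymm := by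
  refine ⟨fun x y => ?_⟩
  obtain ⟨x, rfl⟩ := Submodule.Quotient.mk_surjective _ x
  obtain ⟨y, rfl⟩ := Submodule.Quotient.mk_surjective _ y
  exact X.pairing_middle_comm x.2 y.2

theorem IsPoincare.eq_zero_of_middleForm {X : SymmetricComplex.{u} (4 * k)} (hX : X.IsPoincare)
    {x : X.MiddleCohomology} (h : ∀ z, X.middleForm z x = 0) : x = 0 := by
  obtain ⟨y, rfl⟩ := Submodule.Quotient.mk_surjective _ x
  refine (Submodule.Quotient.mk_eq_zero _).mpr
    (hX.mem_coboundaries_of_pairing_eq_zero (p := 2 * k) (by ring) y.2 fun z hz => ?_)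
  exact h (Submodule.Quotient.mk ⟨z, hz⟩)

theorem Represents.add {X : SymmetricComplex.{u} (4 * k)} {x y : X.MiddleCohomology}
    {u u' : X.C.X (2 * k) →ₗ[ℤ] ℤ} {v v' : X.C.X (2 * k + 1) →ₗ[ℤ] ℤ}
    (hx : X.Represents x u v) (hy : X.Represents y u' v') :
    X.Represents (x + y) (u + u') (v + v') := by
  obtain ⟨hv, hu, rfl⟩ := hx
  obtain ⟨hv', hu', rfl⟩ := hy
  have h : X.reduceTwo (u + u') = X.reduceTwo u + X.reduceTwo u' := LinearMap.comp_add _ _ _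
  refine ⟨by rw [map_add, hv, hv', smul_add], by rw [h]; exact add_mem hu hu', ?_⟩
  rw [← Submodule.Quotient.mk_add]
  congr 1
  exact Subtype.ext h.symm

theorem Represents.middleForm_eq {X : SymmetricComplex.{u} (4 * k)} {x y : X.MiddleCohomology}
    {u u' : X.C.X (2 * k) →ₗ[ℤ] ℤ} {v v' : X.C.X (2 * k + 1) →ₗ[ℤ] ℤ}
    (hx : X.Represents x u v) (hy : X.Represents y u' v') :
    X.middleForm x y = (X.cochainPairing 0 (2 * k) (2 * k) u u' : ℤ) := by
  obtain ⟨hv, hu, rfl⟩ := hx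
  obtain ⟨hv', hu', rfl⟩ := hy
  exact X.pairing_castCochain_castCochain u u'

theorem two_mul_val_intCast (a : ℤ) : 2 * (((a : ZMod 2)).val : ZMod 4) = ((2 * a : ℤ) : ZMod 4) := by
  have h : (((a : ZMod 2).val : ℤ)) = a % 2 := by
    rw [ZMod.val_intCast]; rfl
  have h2 : (2 * (((a : ZMod 2)).val : ZMod 4)) = ((2 * ((a : ZMod 2).val : ℤ) : ℤ) : ZMod 4) := by
    push_cast; rfl
  rw [h2, h]
  exact (ZMod.intCast_eq_intCast_iff_dvd_sub _ _ 4).mpr (by push_cast; omega)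

/-- The Pontryagin square is a quadratic enhancement of the middle form. -/
theorem pontryaginSquare_add (x y : X.MiddleCohomology) :
    X.pontryaginSquare (x + y) = X.pontryaginSquare x + X.pontryaginSquare y +
      2 * ((X.middleForm x y).val : ZMod 4) := by
  obtain ⟨u, v, h⟩ := X.exists_represents x
  obtain ⟨u', v', h'⟩ := X.exists_represents y
  rw [X.pontryaginSquare_eq h, X.pontryaginSquare_eq h', X.pontryaginSquare_eq (h.add h'),
    h.middleForm_eq h', two_mul_val_intCast]
  simp only [pontryaginValue, ← Int.cast_add]
  apply (ZMod.intCast_eq_intCast_iff_dvd_sub _ _ 4).mpr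
  have htwo : ∀ {p : ℤ} (a b : X.C.X p →ₗ[ℤ] ℤ), 2 • a = 2 • b → a = b := fun a b hab =>
    LinearMap.ext fun c => by
      have := LinearMap.congr_fun hab c
      simpa using this
  have hdv' : X.coboundary ℤ (2 * k + 1) (2 * k + 1 + 1) v' = 0 := by
    apply htwo
    rw [← map_nsmul, ← h'.1, smul_zero]
    refine LinearMap.ext fun c => ?_
    change u' (chainD X.C _ _ (chainD X.C _ _ c)) = 0
    rw [X.chainD_chainD, map_zero]
  have e0 : Even (2 * k) := even_two_mul k
  have e1 : (2 * k).negOnePow = 1 := Int.negOnePow_even _ e0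
  have e3 : (4 * k).negOnePow = 1 := Int.negOnePow_even _ ⟨2 * k, by ring⟩
  have e3' : (4 * k + 1).negOnePow = -1 := Int.negOnePow_odd _ ⟨2 * k, by ring⟩
  have e4 : (2 * k * (2 * k)).negOnePow = 1 := Int.negOnePow_even _ (e0.mul_left _)
  have e5 : ((2 * k + 1) * (2 * k)).negOnePow = 1 := Int.negOnePow_even _ (e0.mul_left _)
  have e6 : (1 + 1 : ℤ).negOnePow = 1 := Int.negOnePow_even _ ⟨1, rfl⟩
  -- `a1` measures the asymmetry of `φ_0(u, u')` through `φ_1`. `a2` uses `φ_2` to show that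
  -- `φ_1(v', u) + φ_1(u, v')` is even, so that the leftover terms vanish modulo `4`.
  have a1 := X.pairing_succ_relation (R := ℤ) 0 (p := 2 * k) (q := 2 * k) rfl rfl u u'
  have a2 := X.pairing_succ_relation (R := ℤ) 1 (p := 2 * k + 1) (q := 2 * k) rfl rfl v' u
  simp only [h.1, h'.1, hdv', e1, e3, e3', e4, e5, e6, map_nsmul, map_zero, LinearMap.smul_apply,
    LinearMap.zero_apply, Units.val_one, Units.val_neg, smul_eq_mul, nsmul_eq_mul,
    Nat.cast_ofNat, Nat.cast_zero, Nat.cast_one, zero_add, add_zero, Int.negOnePow_one] at a1 a2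
  simp only [map_add, LinearMap.add_apply]
  push_cast
  omega

theorem castHom_pontryaginSquare (x : X.MiddleCohomology) :
    ZMod.castHom (by norm_num : 2 ∣ 4) (ZMod 2) (X.pontryaginSquare x) = X.middleForm x x := by
  obtain ⟨u, v, h⟩ := X.exists_represents x
  rw [X.pontryaginSquare_eq h, h.middleForm_eq h, pontryaginValue, map_intCast]
  apply (ZMod.intCast_eq_intCast_iff_dvd_sub _ _ 2).mpr
  push_cast
  omega

/-- The reduction of integral cocycles to classes mod 2. -/
def reduction : X.cocycles ℤ (2 * k) →+ X.MiddleCohomology where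
  toFun z := Submodule.Quotient.mk ⟨X.castCochain (ZMod 2) z.1, X.castCochain_mem_cocycles z.2⟩
  map_zero' := (Submodule.Quotient.mk_eq_zero _).mpr (by
    change X.castCochain (ZMod 2) 0 ∈ X.coboundaries (ZMod 2) (2 * k)
    rw [map_zero]; exact zero_mem _)
  map_add' z z' := by
    rw [← Submodule.Quotient.mk_add]
    congr 1
    exact Subtype.ext (map_add _ _ _)

theorem represents_reduction (z : X.cocycles ℤ (2 * k)) : X.Represents (X.reduction z) z.1 0 :=
  ⟨by rw [smul_zero]; exact LinearMap.mem_ker.mp z.2, X.castCochain_mem_cocycles z.2, rfl⟩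

theorem pontryaginSquare_reduction (z : X.cocycles ℤ (2 * k)) :
    X.pontryaginSquare (X.reduction z) = (X.cochainPairing 0 (2 * k) (2 * k) z.1 z.1 : ℤ) := by
  rw [X.pontryaginSquare_eq (X.represents_reduction z), pontryaginValue]
  simp

theorem middleForm_reduction (z z' : X.cocycles ℤ (2 * k)) :
    X.middleForm (X.reduction z) (X.reduction z') =
      (X.cochainPairing 0 (2 * k) (2 * k) z.1 z'.1 : ℤ) :=
  (X.represents_reduction z).middleForm_eq (X.represents_reduction z')

/-- The reductions mod 2 of the integral cocycles that vanish on cycles. -/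
def torsionReduction : AddSubgroup X.MiddleCohomology :=
  AddSubgroup.map X.reduction
    { carrier := {z | X.VanishesOnCycles z.1}
      zero_mem' := fun _ _ => rfl
      add_mem' := fun {a b} ha hb c hc => by
        change a.1 c + b.1 c = 0
        rw [ha c hc, hb c hc, add_zero]
      neg_mem' := fun {a} ha c hc => by
        change -(a.1 c) = 0
        rw [ha c hc, neg_zero] }

theorem middleForm_reduction_torsionReduction (z : X.cocycles ℤ (2 * k)) {a : X.MiddleCohomology}
    (ha : a ∈ X.torsionReduction) : X.middleForm (X.reduction z) a = 0 := by
  obtain ⟨t, ht, rfl⟩ := ha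
  rw [middleForm_reduction, VanishesOnCycles.pairing_eq_zero ht z.2, Int.cast_zero]

theorem IsPoincare.mem_torsionReduction {X : SymmetricComplex.{u} (4 * k)} (hX : X.IsPoincare)
    {x : X.MiddleCohomology} (h : ∀ z, X.middleForm (X.reduction z) x = 0) :
    x ∈ X.torsionReduction := by
  obtain ⟨y, rfl⟩ := Submodule.Quotient.mk_surjective _ x
  have hy : ∀ c, chainD X.C (2 * k) (2 * k - 1) c = 0 → y.1 c = 0 := fun c hc =>
    hX.apply_cycle_eq_zero (p := 2 * k) (by ring) y.2
      (fun z hz => by rw [← pairing_castCochain]; exact h ⟨z, hz⟩) hc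
  have := X.free (2 * k - 1)
  have := X.finite (2 * k - 1)
  obtain ⟨π, hπ, hπ'⟩ := exists_projection_ker (chainD X.C (2 * k) (2 * k - 1))
  obtain ⟨w, hw⟩ := X.exists_reduceTwo_eq y.1
  -- Subtracting `w ∘ₗ π` makes the integral lift vanish on cycles, and changes nothing modulo `2`
  -- because `y` already vanishes on cycles.
  have ht : X.VanishesOnCycles (w - w ∘ₗ π) := fun c hc => by
    rw [LinearMap.sub_apply, LinearMap.comp_apply, hπ' c hc, sub_self]
  refine ⟨⟨_, ht.mem_cocycles⟩, ht, ?_⟩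
  change Submodule.Quotient.mk _ = Submodule.Quotient.mk _
  congr 1
  refine Subtype.ext (LinearMap.ext fun c => ?_)
  change (((w - w ∘ₗ π) c : ℤ) : ZMod 2) = y.1 c
  have hwc : ∀ c, ((w c : ℤ) : ZMod 2) = y.1 c := fun c => LinearMap.congr_fun hw c
  rw [LinearMap.sub_apply, LinearMap.comp_apply, Int.cast_sub, hwc, hwc, hy _ (hπ c), sub_zero]

theorem IsPoincare.middleForm_nondegenerate {X : SymmetricComplex.{u} (4 * k)}
    (hX : X.IsPoincare) : X.middleForm.Nondegenerate := by
  have hsymm := X.middleForm_isSymm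
  refine ⟨fun x h => hX.eq_zero_of_middleForm fun z => ?_, fun x h => hX.eq_zero_of_middleForm h⟩
  rw [hsymm.eq]
  exact h z

/-- If `J` is the image of the integral cocycles and `T` the torsion reductions, then `J^⊥ ⊆ T`, so
`T^⊥ ⊆ J^⊥⊥ = J` by nondegeneracy; the reverse inclusion holds as torsion is in the radical. -/
theorem IsPoincare.exists_reduction_eq_iff {X : SymmetricComplex.{u} (4 * k)} (hX : X.IsPoincare)
    (x : X.MiddleCohomology) :
    (∀ a : X.torsionReduction, X.middleForm x a = 0) ↔ ∃ z, X.reduction z = x := by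
  constructor
  · intro h
    let J : Submodule (ZMod 2) X.MiddleCohomology :=
      AddSubgroup.toZModSubmodule 2 X.reduction.range
    have hJ : X.middleForm.orthogonal (X.middleForm.orthogonal J) = J :=
      LinearMap.BilinForm.orthogonal_orthogonal hX.middleForm_nondegenerate
        X.middleForm_isSymm.isRefl J
    have hx : x ∈ X.middleForm.orthogonal (X.middleForm.orthogonal J) := by
      rw [LinearMap.BilinForm.mem_orthogonal_iff]
      intro a ha
      rw [LinearMap.BilinForm.mem_orthogonal_iff] at ha
      change X.middleForm a x = 0
      rw [X.middleForm_isSymm.eq]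
      exact h ⟨a, hX.mem_torsionReduction fun z => ha _ ⟨z, rfl⟩⟩
    rw [hJ] at hx
    exact hx
  · rintro ⟨z, rfl⟩ a
    exact X.middleForm_reduction_torsionReduction z a.2

/-- The Gauss sum of the Pontryagin square has the phase of the signature. -/
theorem IsPoincare.exists_gaussSum_pontryaginSquare {X : SymmetricComplex.{u} (4 * k)}
    (hX : X.IsPoincare) [Fintype X.MiddleCohomology] :
    ∃ c : ℝ, 0 < c ∧ ∑ x, ZMod.stdAddChar (X.pontryaginSquare x) =
      c * Complex.exp (Real.pi * Complex.I / 4 * X.signature) := by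
  classical
  have : Fintype X.torsionReduction := Fintype.ofFinite _
  let e : X.MiddleCohomology → ℂ := fun x => ZMod.stdAddChar (X.pontryaginSquare x)
  have hP : ∀ a ∈ X.torsionReduction, X.pontryaginSquare a = 0 := by
    rintro a ⟨t, ht, rfl⟩
    rw [pontryaginSquare_reduction, VanishesOnCycles.pairing_eq_zero ht t.2, Int.cast_zero]
  let χ : X.MiddleCohomology → AddChar X.torsionReduction ℂ := fun x =>
    (ZMod.stdAddChar (N := 2)).compAddMonoidHom
      ((X.middleForm x).toAddMonoidHom.comp X.torsionReduction.subtype)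
  have hχ : ∀ x (a : X.torsionReduction), e (x + a) = e x * χ x a := fun x a => by
    simp only [e, χ, pontryaginSquare_add, hP a a.2, add_zero, AddChar.map_add_eq_mul,
      stdAddChar_four_two_mul]
    rfl
  have h1 := sum_eq_sum_filter_of_translate (fun a : X.torsionReduction => (a : X.MiddleCohomology))
    e χ hχ
  have h2 : ∀ x, (∀ a, χ x a = 1) ↔ ∃ z, X.reduction z = x := fun x => by
    rw [← hX.exists_reduction_eq_iff]
    refine forall_congr' fun a => ?_
    change ZMod.stdAddChar (X.middleForm x a) = 1 ↔ _
    rw [← AddChar.map_zero_eq_one (ZMod.stdAddChar (N := 2)), ZMod.injective_stdAddChar.eq_iff]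
  simp only [h2] at h1
  obtain ⟨m, z, hz, c, hc, hsum⟩ := hX.exists_lattice_gaussSum
  let ρ : ZMod 4 →+* ZMod 2 := ZMod.castHom (by norm_num) _
  -- The image of the integral cocycles is parametrised by lattice coordinates modulo `4`, to match
  -- the lattice Gauss sum, together with a torsion part that `P₂` ignores.
  let ψ : (Fin m → ZMod 4) × X.torsionReduction →+ X.MiddleCohomology :=
    { toFun := fun x => ∑ i, ρ (x.1 i) • X.reduction (z i) + x.2
      map_zero' := by simp
      map_add' := fun x y => by
        simp only [Prod.fst_add, Prod.snd_add, Pi.add_apply, map_add, add_smul,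
          Finset.sum_add_distrib, AddSubgroup.coe_add]
        abel }
  have hψ : ∀ (n : Fin m → ℤ) (t : X.cocycles ℤ (2 * k)) (ht : X.VanishesOnCycles t.1),
      ψ (fun i => (n i : ZMod 4), ⟨X.reduction t, t, ht, rfl⟩) =
        X.reduction (∑ i, n i • z i + t) := fun n t ht => by
    simp only [ψ, AddMonoidHom.coe_mk, ZeroHom.coe_mk, map_intCast, map_add, map_sum, map_zsmul,
      Int.cast_smul_eq_zsmul]
  have hrange : ∀ x, (∃ z, X.reduction z = x) ↔ ∃ y, ψ y = x := fun x => by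
    constructor
    · rintro ⟨y, rfl⟩
      obtain ⟨n, hn⟩ := hz y
      exact ⟨_, (hψ n _ hn).trans (by rw [add_sub_cancel])⟩
    · rintro ⟨⟨l, a, t, ht, rfl⟩, rfl⟩
      choose n hn using fun i => ZMod.intCast_surjective (l i)
      obtain rfl : (fun i => (n i : ZMod 4)) = l := funext hn
      exact ⟨_, (hψ n t ht).symm⟩
  obtain ⟨K, hK, h3⟩ := exists_sum_comp_eq_mul_sum_range ψ
  have h3 := h3 e
  simp only [hrange] at h1
  rw [← h1] at h3
  have h4 : ∀ y, e (ψ y) = ZMod.stdAddChar (∑ i, y.1 i * ∑ j,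
        (X.cochainPairing 0 (2 * k) (2 * k) (z i).1 (z j).1 : ZMod 4) * y.1 j) := by
    rintro ⟨l, a, t, ht, rfl⟩
    choose n hn using fun i => ZMod.intCast_surjective (l i)
    obtain rfl : (fun i => (n i : ZMod 4)) = l := funext hn
    have h5 := hψ n t ht
    simp only [e]
    refine congrArg _ ((congrArg _ h5).trans ?_)
    let b : X.cocycles ℤ (2 * k) →ₗ[ℤ] X.cocycles ℤ (2 * k) →ₗ[ℤ] ℤ :=
      (X.cochainPairing 0 (2 * k) (2 * k)).domRestrict₁₂ _ _
    have hb : ∀ x y, X.cochainPairing 0 (2 * k) (2 * k) x.1 y.1 = b x y := fun _ _ => rfl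
    have hb1 : ∀ x, b x t = 0 := fun x => ht.pairing_eq_zero x.2
    have hb2 : ∀ x, b t x = 0 := fun x => (X.pairing_middle_comm t.2 x.2).trans (hb1 x)
    have hb3 : ∀ s, b (s + t) (s + t) = b s s := fun s => by
      simp only [map_add, LinearMap.add_apply, hb1, hb2, add_zero]
    rw [pontryaginSquare_reduction, hb, hb3]
    simp only [map_sum, map_zsmul, LinearMap.sum_apply, LinearMap.smul_apply, smul_eq_mul, hb]
    push_cast
    simp only [Finset.mul_sum]
    rw [Finset.sum_comm]
    exact Finset.sum_congr rfl fun i _ => Finset.sum_congr rfl fun j _ => by ring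
  simp only [h4] at h3
  rw [Fintype.sum_prod_type] at h3
  simp only [Finset.sum_const, Finset.card_univ, nsmul_eq_mul, ← Finset.mul_sum] at h3
  rw [hsum] at h3
  have hA : 0 < Fintype.card X.torsionReduction := Fintype.card_pos
  refine ⟨Fintype.card X.torsionReduction * c / K, by positivity, ?_⟩
  have : (K : ℂ) ≠ 0 := by exact_mod_cast hK.ne'
  rw [mul_comm (K : ℂ), ← div_eq_iff this] at h3
  change ∑ x, e x = _
  rw [← h3]
  push_cast
  ring

end PontryaginSquare

end SymmetricComplex

/-! ### Algebra of `ℤ/4`-valued enhancements: Wu class, sublagrangians and the Arf invariant. -/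

section Enhancements

variable {V : Type*} [AddCommGroup V] [Module (ZMod 2) V] {lam : LinearMap.BilinForm (ZMod 2) V}

/-- In characteristic two the cross terms cancel, so `x ↦ λ(x, x)` is linear and is represented by a
unique vector. -/
theorem existsUnique_self_pairing [Finite V] (hs : lam.IsSymm) (hn : lam.Nondegenerate) :
    ∃! v : V, ∀ x, lam x x = lam x v := by
  have : Module.Finite (ZMod 2) V := Module.Finite.of_finite
  let f : Module.Dual (ZMod 2) V :=
    { toFun := fun x => lam x x
      map_add' := fun x y => by
        have h2 : lam x y + lam x y = 0 := CharTwo.add_self_eq_zero _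
        simp only [map_add, LinearMap.add_apply]
        rw [hs.eq y x]
        linear_combination h2
      map_smul' := fun a x => by
        simp only [map_smul, LinearMap.smul_apply, smul_eq_mul, RingHom.id_apply]
        rw [← mul_assoc]
        congr 1
        revert a
        decide }
  have hv : ∀ x, lam x x = lam x ((LinearMap.BilinForm.toDual lam hn).symm f) := fun x => by
    rw [hs.eq x ((LinearMap.BilinForm.toDual lam hn).symm f), LinearMap.BilinForm.apply_toDual_symm_apply]
    rfl
  refine ⟨_, hv, fun w hw => ?_⟩
  rw [← sub_eq_zero]
  refine hn.2 _ fun x => ?_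
  rw [map_sub, ← hw x, ← hv x, sub_self]

theorem mem_span_singleton_zmod_two {v x : V} :
    x ∈ Submodule.span (ZMod 2) {v} ↔ x = 0 ∨ x = v := by
  rw [Submodule.mem_span_singleton]
  constructor
  · rintro ⟨a, rfl⟩
    have : a = 0 ∨ a = 1 := by revert a; decide
    rcases this with rfl | rfl <;> simp
  · rintro (rfl | rfl)
    · exact ⟨0, by simp⟩
    · exact ⟨1, by simp⟩

/-- A `ℤ/4`-valued quadratic enhancement of a symmetric form over `ℤ/2`. -/
structure IsEnhancement (lam : LinearMap.BilinForm (ZMod 2) V) (q : V → ZMod 4) : Prop where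
  add : ∀ x y, q (x + y) = q x + q y + 2 * ((lam x y).val : ZMod 4)
  self : ∀ x, ZMod.castHom (by norm_num : 2 ∣ 4) (ZMod 2) (q x) = lam x x

variable {q : V → ZMod 4}

theorem IsEnhancement.map_zero (hq : IsEnhancement lam q) : q 0 = 0 := by
  have h := hq.add 0 0
  simp only [add_zero, _root_.map_zero, ZMod.val_zero, Nat.cast_zero, mul_zero] at h
  exact left_eq_add.mp h

/-- The span is `{0, v}`, and `q v = 0` already forces `λ(v, v) = 0`, its reduction modulo `2`. -/
theorem IsEnhancement.isSublagrangian_span_iff (hq : IsEnhancement lam q) (v : V) :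
    IsSublagrangian lam q (Submodule.span (ZMod 2) {v}) ↔ q v = 0 := by
  constructor
  · exact fun h => h.2 v (Submodule.mem_span_singleton_self v)
  · intro h
    have hv : lam v v = 0 := by rw [← hq.self, h, _root_.map_zero]
    refine ⟨fun x hx y hy => ?_, fun x hx => ?_⟩
    · rcases mem_span_singleton_zmod_two.mp hx with rfl | rfl <;>
      rcases mem_span_singleton_zmod_two.mp hy with rfl | rfl <;> simp [hv]
    · rcases mem_span_singleton_zmod_two.mp hx with rfl | rfl
      · exact hq.map_zero
      · exact h

/-- The Gauss sum of an enhancement determines its value on the Wu class. -/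
theorem IsEnhancement.wuClass_eq [Fintype V] (hq : IsEnhancement lam q) {v : V}
    (hv : ∀ x, lam x x = lam x v) {c : ℝ} (hc : 0 < c) {σ : ℤ}
    (hG : ∑ x, ZMod.stdAddChar (q x) = c * Complex.exp (Real.pi * Complex.I / 4 * σ)) :
    q v = (σ : ZMod 4) := by
  -- The cross term is `2λ(x, x) = 2 q(x)`, and `3 = -1` in `ℤ/4`.
  have h1 : ∀ x, q (x + v) = q v + -q x := fun x => by
    rw [hq.add, ← hv x, ← hq.self x]
    generalize q x = a
    generalize q v = b
    revert a b
    decide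
  have h2 : ∑ x, ZMod.stdAddChar (q x) =
      ZMod.stdAddChar (q v) * (starRingEnd ℂ) (∑ x, ZMod.stdAddChar (q x)) := by
    rw [map_sum, Finset.mul_sum]
    calc ∑ x, ZMod.stdAddChar (q x) = ∑ x, ZMod.stdAddChar (q (x + v)) :=
        (Equiv.sum_comp (Equiv.addRight v) fun x => ZMod.stdAddChar (q x)).symm
      _ = _ := Finset.sum_congr rfl fun x _ => by
        rw [h1, AddChar.map_add_eq_mul, AddChar.map_neg_eq_conj]
  apply ZMod.injective_stdAddChar
  have hcC : (c : ℂ) ≠ 0 := by exact_mod_cast hc.ne'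
  rw [hG, map_mul, Complex.conj_ofReal, ← Complex.exp_conj, mul_left_comm] at h2
  have h3 := mul_left_cancel₀ hcC h2
  have h4 : (starRingEnd ℂ) (Real.pi * Complex.I / 4 * σ) = -(Real.pi * Complex.I / 4 * σ) := by
    simp [neg_div, map_ofNat]
  rw [h4, Complex.exp_neg, ← div_eq_mul_inv, eq_div_iff (Complex.exp_ne_zero _),
    ← Complex.exp_add] at h3
  rw [← h3, ZMod.stdAddChar_coe]
  congr 1
  push_cast
  ring

/-- The form induced on `L^⊥ / L`. -/
def perpForm (lam : LinearMap.BilinForm (ZMod 2) V) (hs : lam.IsSymm) (L : Submodule (ZMod 2) V) :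
    LinearMap.BilinForm (ZMod 2) (PerpQuotient lam L) :=
  Submodule.liftQ _
    (LinearMap.flip <| Submodule.liftQ _ (LinearMap.flip <|
      lam.domRestrict₁₂ (lam.orthogonal L) (lam.orthogonal L))
      fun y hy => LinearMap.ext fun x => by
        have := LinearMap.BilinForm.mem_orthogonal_iff.mp x.2 y.1 hy
        change lam x.1 y.1 = 0
        rw [hs.eq]
        exact this)
    fun x hx => LinearMap.ext fun y => by
      obtain ⟨y, rfl⟩ := Submodule.Quotient.mk_surjective _ y
      exact LinearMap.BilinForm.mem_orthogonal_iff.mp y.2 x.1 hx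

theorem perpForm_mk (hs : lam.IsSymm) {L : Submodule (ZMod 2) V} (x y : lam.orthogonal L) :
    perpForm lam hs L (Submodule.Quotient.mk x) (Submodule.Quotient.mk y) = lam x y := rfl

theorem perpForm_isSymm (hs : lam.IsSymm) (L : Submodule (ZMod 2) V) :
    (perpForm lam hs L).IsSymm := by
  refine ⟨fun x y => ?_⟩
  obtain ⟨x, rfl⟩ := Submodule.Quotient.mk_surjective _ x
  obtain ⟨y, rfl⟩ := Submodule.Quotient.mk_surjective _ y
  exact hs.eq x.1 y.1

/-- A class orthogonal to all of `L^⊥` lies in `L^⊥⊥ = L`; surjectivity is then a dimension count.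
-/
theorem perpForm_bijective [Finite V] (hs : lam.IsSymm) (hn : lam.Nondegenerate)
    (L : Submodule (ZMod 2) V) : Function.Bijective (perpForm lam hs L) := by
  have : Module.Finite (ZMod 2) V := Module.Finite.of_finite
  have hinj : Function.Injective (perpForm lam hs L) := by
    rw [injective_iff_map_eq_zero]
    intro x hx
    obtain ⟨x, rfl⟩ := Submodule.Quotient.mk_surjective _ x
    refine (Submodule.Quotient.mk_eq_zero _).mpr ?_
    have h : x.1 ∈ lam.orthogonal (lam.orthogonal L) :=
      LinearMap.BilinForm.mem_orthogonal_iff.mpr fun y hy =>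
        (hs.eq y x.1).trans (LinearMap.congr_fun hx (Submodule.Quotient.mk ⟨y, hy⟩))
    rw [LinearMap.BilinForm.orthogonal_orthogonal hn hs.isRefl] at h
    exact h
  exact ⟨hinj, (LinearMap.injective_iff_surjective_of_finrank_eq_finrank
    Subspace.dual_finrank_eq.symm).mp hinj⟩

/-- Half of an even element of `ℤ/4`. -/
def halfOfEven (a : ZMod 4) : ZMod 2 := if a = 2 then 1 else 0

theorem two_mul_halfOfEven : ∀ a : ZMod 4, ZMod.castHom (by norm_num : 2 ∣ 4) (ZMod 2) a = 0 →
    a = 2 * ((halfOfEven a).val : ZMod 4) := by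
  unfold halfOfEven; decide

theorem halfOfEven_add : ∀ (a b : ZMod 4) (c : ZMod 2),
    ZMod.castHom (by norm_num : 2 ∣ 4) (ZMod 2) a = 0 →
    ZMod.castHom (by norm_num : 2 ∣ 4) (ZMod 2) b = 0 →
    halfOfEven (a + b + 2 * (c.val : ZMod 4)) = halfOfEven a + halfOfEven b + c := by
  unfold halfOfEven; decide

theorem IsEnhancement.add_sublagrangian (hq : IsEnhancement lam q) (hs : lam.IsSymm)
    {L : Submodule (ZMod 2) V} (hL : IsSublagrangian lam q L) {x a : V}
    (hx : x ∈ lam.orthogonal L) (ha : a ∈ L) : q (x + a) = q x := by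
  have : lam x a = 0 := (hs.eq x a).trans (LinearMap.BilinForm.mem_orthogonal_iff.mp hx a ha)
  rw [hq.add, hL.2 a ha, this]
  simp

/-- The quadratic form `q / 2` on `L^⊥ / L`, when `q` is even on `L^⊥`. -/
theorem exists_perpQuadraticForm (hs : lam.IsSymm) (hq : IsEnhancement lam q) {L : Submodule (ZMod 2) V}
    (hL : IsSublagrangian lam q L) (heven : ∀ x ∈ lam.orthogonal L, lam x x = 0) :
    ∃ h : QuadraticForm (ZMod 2) (PerpQuotient lam L),
      (∀ x : lam.orthogonal L, q x = 2 * ((h (Submodule.Quotient.mk x)).val : ZMod 4)) ∧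
      ∀ x y, h (x + y) = h x + h y + perpForm lam hs L x y := by
  let f : PerpQuotient lam L → ZMod 2 := fun w => halfOfEven (q (Quotient.out w).1)
  have hf : ∀ x : lam.orthogonal L, f (Submodule.Quotient.mk x) = halfOfEven (q x) := fun x => by
    have h : (Submodule.Quotient.mk (Quotient.out (Submodule.Quotient.mk x : PerpQuotient lam L)) :
        PerpQuotient lam L) = Submodule.Quotient.mk x := Quotient.out_eq _
    have h2 := hq.add_sublagrangian hs hL x.2 ((Submodule.Quotient.eq (L.submoduleOf (lam.orthogonal L))).mp h)
    simp only [f]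
    rw [← h2]
    congr 2
    simp
  have h0 : ∀ x : lam.orthogonal L,
      ZMod.castHom (by norm_num : 2 ∣ 4) (ZMod 2) (q x) = 0 := fun x => by
    rw [hq.self, heven x x.2]
  have hfadd : ∀ x y, f (x + y) = f x + f y + perpForm lam hs L x y := fun x y => by
    obtain ⟨x, rfl⟩ := Submodule.Quotient.mk_surjective _ x
    obtain ⟨y, rfl⟩ := Submodule.Quotient.mk_surjective _ y
    rw [← Submodule.Quotient.mk_add, hf, hf, hf, perpForm_mk, Submodule.coe_add, hq.add,
      halfOfEven_add _ _ _ (h0 x) (h0 y)]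
  -- Over `ℤ/2` homogeneity only demands that the form vanish at `0`.
  refine ⟨⟨f, fun a x => ?_, perpForm lam hs L, hfadd⟩, fun x => ?_, hfadd⟩
  · have : a = 0 ∨ a = 1 := by revert a; decide
    rcases this with rfl | rfl
    · rw [zero_smul, mul_zero, zero_smul]
      have := hf 0
      rw [Submodule.Quotient.mk_zero, Submodule.coe_zero, hq.map_zero] at this
      exact this
    · simp
  · change q x = 2 * ((f (Submodule.Quotient.mk x)).val : ZMod 4)
    rw [hf]
    exact two_mul_halfOfEven _ (h0 x)

theorem sum_stdAddChar_two {W : Type*} [Fintype W] (h : W → ZMod 2) :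
    ∑ w, ZMod.stdAddChar (h w) =
      ((Nat.card {w // h w = 0} - Nat.card {w // h w = 1} : ℝ) : ℂ) := by
  classical
  have h1 : ∀ a : ZMod 2, ZMod.stdAddChar a =
      (if a = 0 then 1 else 0) - (if a = 1 then (1 : ℂ) else 0) := by
    intro a
    have : a = 0 ∨ a = 1 := by revert a; decide
    rcases this with rfl | rfl
    · simp
    · have := ZMod.stdAddChar_coe (N := 2) 1
      rw [Int.cast_one] at this
      rw [this]
      have h2 : (2 * Real.pi * Complex.I * ((1 : ℤ) : ℂ) / ((2 : ℕ) : ℂ)) =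
          Real.pi * Complex.I := by
        push_cast; ring
      rw [h2, Complex.exp_pi_mul_I]
      simp
  simp only [h1, Finset.sum_sub_distrib, Finset.sum_boole, Nat.card_eq_fintype_card,
    Fintype.card_subtype]
  push_cast
  rfl

/-- Translation by `L` localises the Gauss sum to `L^⊥`, whence it descends to a positive multiple
of `∑ (-1) ^ h` on `L^⊥ / L`. Its sign is compared with the phase `exp(πiσ/4)`, which is real since
`4 ∣ σ`. -/
theorem IsEnhancement.signature_eq_arfInvariant [Fintype V] (hs : lam.IsSymm)
    (hq : IsEnhancement lam q) {L : Submodule (ZMod 2) V} (hL : IsSublagrangian lam q L)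
    {c : ℝ} (hc : 0 < c) {σ : ℤ} (hσ : (4 : ℤ) ∣ σ)
    (hG : ∑ x, ZMod.stdAddChar (q x) = c * Complex.exp (Real.pi * Complex.I / 4 * σ))
    (h : QuadraticForm (ZMod 2) (PerpQuotient lam L))
    (hh : ∀ x : lam.orthogonal L, q x = 2 * ((h (Submodule.Quotient.mk x)).val : ZMod 4)) :
    (σ : ZMod 8) = 4 * ((arfInvariant h).val : ZMod 8) := by
  classical
  have : Fintype L := Fintype.ofFinite _
  have : Fintype (lam.orthogonal L) := Fintype.ofFinite _
  have : Fintype (PerpQuotient lam L) :=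
    @Fintype.ofFinite _ (Finite.of_surjective _ (Submodule.mkQ_surjective _))
  let χ : V → AddChar L ℂ := fun x =>
    (ZMod.stdAddChar (N := 2)).compAddMonoidHom ((lam x).toAddMonoidHom.comp L.subtype.toAddMonoidHom)
  have h1 := sum_eq_sum_filter_of_translate (fun a : L => (a : V))
    (fun x => (ZMod.stdAddChar (q x) : ℂ)) χ fun x a => by
      rw [hq.add, hL.2 a a.2, add_zero, AddChar.map_add_eq_mul, stdAddChar_four_two_mul]
      rfl
  have h2 : ∀ x, (∀ a, χ x a = 1) ↔ x ∈ lam.orthogonal L := fun x => by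
    rw [LinearMap.BilinForm.mem_orthogonal_iff]
    have : ∀ a : L, χ x a = 1 ↔ lam a x = 0 := fun a => by
      change ZMod.stdAddChar (lam x a) = 1 ↔ _
      rw [← AddChar.map_zero_eq_one (ZMod.stdAddChar (N := 2)), ZMod.injective_stdAddChar.eq_iff,
        hs.eq]
    simp only [this]
    exact ⟨fun h a ha => h ⟨a, ha⟩, fun h a => h a a.2⟩
  simp only [h2] at h1
  rw [hG, Finset.sum_subtype (p := fun x => x ∈ lam.orthogonal L) _ (by simp)] at h1
  obtain ⟨K, hK, h3⟩ := exists_sum_comp_eq_mul_sum_range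
    (L.submoduleOf (lam.orthogonal L)).mkQ.toAddMonoidHom
  have h3 := h3 fun w => ZMod.stdAddChar (h w)
  have hsurj : ∀ w, ∃ x, (L.submoduleOf (lam.orthogonal L)).mkQ.toAddMonoidHom x = w :=
    Submodule.mkQ_surjective _
  rw [Finset.filter_true_of_mem fun w _ => hsurj w] at h3
  have h4 : ∑ x : lam.orthogonal L, (ZMod.stdAddChar (q x) : ℂ) =
      K * ∑ w, ZMod.stdAddChar (h w) := by
    rw [← h3]
    refine Finset.sum_congr rfl fun x _ => ?_
    rw [hh, stdAddChar_four_two_mul]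
    rfl
  rw [h4, sum_stdAddChar_two] at h1
  obtain ⟨s, rfl⟩ := hσ
  have h5 : Complex.exp (Real.pi * Complex.I / 4 * ((4 * s : ℤ) : ℂ)) = ((-1 : ℝ) ^ s : ℝ) := by
    rw [show (Real.pi * Complex.I / 4 * ((4 * s : ℤ) : ℂ)) = s * (Real.pi * Complex.I) by
      push_cast; ring, Complex.exp_int_mul, Complex.exp_pi_mul_I]
    push_cast; rfl
  rw [h5] at h1
  have h6 : c * (-1 : ℝ) ^ s =
      K * (Nat.card {w // h w = 0} - Nat.card {w // h w = 1} : ℝ) := by exact_mod_cast h1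
  have hK' : (0 : ℝ) < K := by exact_mod_cast hK
  unfold arfInvariant
  rcases Int.even_or_odd s with hs2 | hs2
  · rw [hs2.neg_one_zpow, mul_one] at h6
    have h7 : (0 : ℝ) < (Nat.card {w // h w = 0} - Nat.card {w // h w = 1} : ℝ) := by
      by_contra hcon
      nlinarith
    rw [if_pos (by exact_mod_cast sub_pos.mp h7)]
    obtain ⟨t, rfl⟩ := hs2
    simp only [ZMod.val_zero, Nat.cast_zero, mul_zero]
    exact (ZMod.intCast_zmod_eq_zero_iff_dvd _ 8).mpr ⟨t, by push_cast; ring⟩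
  · rw [hs2.neg_one_zpow] at h6
    have h7 : (Nat.card {w // h w = 0} - Nat.card {w // h w = 1} : ℝ) < 0 := by
      by_contra hcon
      nlinarith
    -- The inequality `h7` is strict, so the `else` value `1` is here a true majority and not a tie.
    rw [if_neg (by rw [not_lt]; exact_mod_cast (sub_neg.mp h7).le)]
    obtain ⟨t, rfl⟩ := hs2
    have : ((4 * (2 * t + 1) : ℤ) : ZMod 8) = ((4 : ℤ) : ZMod 8) :=
      (ZMod.intCast_eq_intCast_iff_dvd_sub _ _ 8).mpr ⟨-t, by push_cast; ring⟩
    rw [this]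
    decide

/-- A Gauss sum of the phase of `σ` determines `σ` modulo `4` and `8` by the Wu class. -/
theorem IsEnhancement.modEq_and_eq_arfInvariant [Fintype V] (hs : lam.IsSymm)
    (hn : lam.Nondegenerate) (hq : IsEnhancement lam q) {c : ℝ} (hc : 0 < c) {σ : ℤ}
    (hG : ∑ x, ZMod.stdAddChar (q x) = c * Complex.exp (Real.pi * Complex.I / 4 * σ))
    {v : V} (hv : ∀ x, lam x x = lam x v) {L : Submodule (ZMod 2) V}
    (hLv : L = Submodule.span (ZMod 2) {v}) :
    (σ ≡ 0 [ZMOD 4] ↔ IsSublagrangian lam q L) ∧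
    (IsSublagrangian lam q L → L ≤ lam.orthogonal L ∧
      ∃ (μ : LinearMap.BilinForm (ZMod 2) (PerpQuotient lam L))
        (h : QuadraticForm (ZMod 2) (PerpQuotient lam L)),
        (∀ x y : lam.orthogonal L,
          μ (Submodule.Quotient.mk x) (Submodule.Quotient.mk y) = lam x y) ∧
        μ.IsSymm ∧ Function.Bijective μ ∧
        (∀ x : lam.orthogonal L, q x = 2 * ((h (Submodule.Quotient.mk x)).val : ZMod 4)) ∧
        (∀ x y, h (x + y) = h x + h y + μ x y) ∧
        (σ : ZMod 8) = 4 * ((arfInvariant h).val : ZMod 8)) := by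
  have hsub : σ ≡ 0 [ZMOD 4] ↔ IsSublagrangian lam q L := by
    rw [hLv, hq.isSublagrangian_span_iff, hq.wuClass_eq hv hc hG, Int.modEq_zero_iff_dvd,
      ZMod.intCast_zmod_eq_zero_iff_dvd]
    rfl
  refine ⟨hsub, fun hL => ⟨fun x hx => LinearMap.BilinForm.mem_orthogonal_iff.mpr fun y hy =>
    hL.1 y hy x hx, ?_⟩⟩
  -- On `L^⊥` one has `λ(x, x) = λ(x, v) = 0`, so `q` takes even values there.
  obtain ⟨h, hh, hadd⟩ := exists_perpQuadraticForm hs hq hL fun x hx => by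
    rw [hv x, hs.eq]
    exact LinearMap.BilinForm.mem_orthogonal_iff.mp hx v
      (hLv ▸ Submodule.mem_span_singleton_self v)
  exact ⟨perpForm lam hs _, h, perpForm_mk hs, perpForm_isSymm hs _,
    perpForm_bijective hs hn _, hh, hadd, hq.signature_eq_arfInvariant hs hL hc
      (Int.modEq_zero_iff_dvd.mp (hsub.mpr hL)) hG h hh⟩

end Enhancements

end

theorem mainTheorem5 (k : ℤ) (X : SymmetricComplex.{u} (4 * k)) (hX : X.IsPoincare) :
    (∃! v : X.MiddleCohomology, X.IsWuClass v) ∧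
    ∀ (v : X.MiddleCohomology) (L : Submodule (ZMod 2) X.MiddleCohomology),
      X.IsWuClass v → L = Submodule.span (ZMod 2) {v} →
      (X.signature ≡ 0 [ZMOD 4] ↔ IsSublagrangian X.middleForm X.pontryaginSquare L) ∧
      (IsSublagrangian X.middleForm X.pontryaginSquare L →
        L ≤ X.middleForm.orthogonal L ∧
        ∃ (μ : LinearMap.BilinForm (ZMod 2) (PerpQuotient X.middleForm L))
          (h : QuadraticForm (ZMod 2) (PerpQuotient X.middleForm L)),
          (∀ x y : X.middleForm.orthogonal L,
            μ (Submodule.Quotient.mk x) (Submodule.Quotient.mk y) = X.middleForm x y) ∧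
          μ.IsSymm ∧ Function.Bijective μ ∧
          (∀ x : X.middleForm.orthogonal L,
            X.pontryaginSquare x = 2 * ((h (Submodule.Quotient.mk x)).val : ZMod 4)) ∧
          (∀ x y, h (x + y) = h x + h y + μ x y) ∧
          (X.signature : ZMod 8) = 4 * ((arfInvariant h).val : ZMod 8)) := by
  have := Fintype.ofFinite X.MiddleCohomology
  have hq : IsEnhancement X.middleForm X.pontryaginSquare :=
    ⟨X.pontryaginSquare_add, X.castHom_pontryaginSquare⟩
  obtain ⟨c, hc, hG⟩ := hX.exists_gaussSum_pontryaginSquare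
  exact ⟨existsUnique_self_pairing X.middleForm_isSymm hX.middleForm_nondegenerate,
    fun v L hv hL => hq.modEq_and_eq_arfInvariant X.middleForm_isSymm
      hX.middleForm_nondegenerate hc hG hv hL⟩
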